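/- **Setting.** Let $F\in\mathbb C[x_0,x_1,x_2]$ be a squarefree homogeneous polynomial of degree $n>0$, $\mathcal C=\{F=0\}\subset\mathbb P^2_{\mathbb C}$ the reduced plane curve that it defines, and $P\in\mathcal C$ a point. *Type of a double point.* For an integer $s=2r-\varepsilon\ge 1$ with $\varepsilon\in\{0,1\}$, the point $P$ is an $A_s$ singularity of $\mathcal C$ if it is a double point of $\mathcal C$ (multiplicity exactly $2$), it is resolved by exactly $r$ blow-ups (each at a singular point, lying over $P$, of the successive strict transforms, starting with $P$ itself), and exactly $2$ points of the desingularization lie over $P$ if $\varepsilon=1$, exactly $1$ if $\varepsilon=0$. *Algorithm 1.* Given $f=\sum a_{ij}x^iy^j\in\mathbb C[x,y]$ and $\gamma\in\mathbb C[x]$ with $\gamma(0)=0$, let $i(f,\gamma)$ be the least exponent of $x$ that appears in $f(x,\gamma(x))$ (and $\infty$ if $f(x,\gamma(x))=0$); this is the intersection multiplicity at the origin of the curves $f=0$ and $y=\gamma(x)$. * Step 0. Choose projective coordinates in which $P=[0,0,1]$ and let $f(x,y)=F(x,y,1)$ in these coordinates, so that $a_{00}=0$. If $(a_{01},a_{10})\ne(0,0)$,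 stop ($P$ is a simple point). If $a_{01}=a_{10}=0$ and $(a_{20},a_{11},a_{02})=(0,0,0)$, stop ($P$ has multiplicity at least $3$). Otherwise $P$ is a double point; go to Step 1. * Before Step 1, choose projective coordinates in which $P=[0,0,1]$ and in which $f(x,y)=F(x,y,1)$ has $a_{02}\neq0$; this $f$ is used from now on. * Step $r$ ($r\ge1$). The numbers $\bar\lambda_1,\dots,\bar\lambda_{r-1}$ come from the preceding steps. For an unknown $\lambda$ put $\gamma_\lambda(x)=\bar\lambda_1x+\dots+\bar\lambda_{r-1}x^{r-1}+\lambda x^r$. The coefficient of $x^{2r}$ in $f(x,\gamma_\lambda(x))$ is a polynomial of degree two in $\lambda$; let $\Delta_r$ be its discriminant. * Step $r$-a. If $\Delta_r\ne0$, stop. * Step $r$-b. If $\Delta_r=0$, let $\bar\lambda_r$ be the value of $\lambda$ for which $i(f,\gamma_{\bar\lambda_r})\ge 2r+1$. If $i(f,\gamma_{\bar\lambda_r})=2r+1$, stop. If $i(f,\gamma_{\bar\lambda_r})\ge 2r+2$, go to Step $r+1$. **Proposition.** For every choice of the coordinates in the algorithm and for every integer $r\ge1$: 1. Algorithm 1 stops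 at Step $r$-a if and only if $P$ is an $A_{2r-1}$ singularity of $\mathcal C$; 2. Algorithm 1 stops at Step $r$-b if and only if $P$ is an $A_{2r}$ singularity of $\mathcal C$. -/

import Mathlib

/-!
Double points of plane complex curves: affine equations in projective coordinates, the type `A_s`
of a double point (through blow-ups), and the algorithm of successive osculating curves.
-/

noncomputable section

namespace PlaneCurve

open MvPolynomial

/-- The affine equation of the plane projective curve `F = 0` in the system of homogeneous
coordinates given by the invertible matrix `g`: the polynomial `f(x, y) = F(g · (x, y, 1))`.
The origin of this affine chart is the point `g · [0, 0, 1]`. -/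
def affineEq (F : MvPolynomial (Fin 3) ℂ) (g : GL (Fin 3) ℂ) : MvPolynomial (Fin 2) ℂ :=
  aeval (fun i : Fin 3 => C (g.1 i 0) * X 0 + C (g.1 i 1) * X 1 + C (g.1 i 2)) F

/-- The linear change of coordinates `g` brings the point `P` to `[0, 0, 1]`: in other words
`g · (0, 0, 1)` (which is a nonzero vector) lies on the line `P` of `ℂ³`. -/
def IsCentredAt (g : GL (Fin 3) ℂ) (P : Projectivization ℂ (Fin 3 → ℂ)) : Prop :=
  g.1.mulVec ![0, 0, 1] ∈ P.submodule

/-- The coefficient `a_ij` of `x ^ i * y ^ j` in `f`. -/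
def a (f : MvPolynomial (Fin 2) ℂ) (i j : ℕ) : ℂ :=
  coeff (Finsupp.single 0 i + Finsupp.single 1 j) f

/-- The multiplicity at the origin of the affine curve `f = 0`: the least total degree of a
monomial that appears in `f` (and `⊤` for `f = 0`). -/
def mult (f : MvPolynomial (Fin 2) ℂ) : ℕ∞ :=
  (f : MvPowerSeries (Fin 2) ℂ).order

/-! ### Blow-ups and the type of a double point -/

/-- Let `m` be the multiplicity of `f` at the origin. The points of the exceptional line of the
blow-up of the plane at the origin are the directions `y = c x` (written `some c`) and the direction
`x = 0` (written `none`). `strictTransform f m d` is the equation of the strict transform of the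
curve `f = 0`, in affine coordinates of the blow-up centred at the point `d`:
it is `f(x, x (y + c)) / x ^ m` for `d = some c` and `f(x y, y) / y ^ m` for `d = none`. -/
def strictTransform (f : MvPolynomial (Fin 2) ℂ) (m : ℕ) : Option ℂ → MvPolynomial (Fin 2) ℂ
  | some c => (aeval ![X 0, X 0 * (X 1 + C c)] f : MvPolynomial (Fin 2) ℂ).divMonomial
      (Finsupp.single 0 m)
  | none => (aeval ![X 0 * X 1, X 1] f : MvPolynomial (Fin 2) ℂ).divMonomial
      (Finsupp.single 1 m)

/-- `ResolvedBy f n k`: the curve `f = 0`, which passes through the origin, is resolved over the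
origin by exactly `n` blow-ups (each of them at a singular point of the successive strict
transforms, starting with the origin), and exactly `k` points of the
resulting desingularization lie over the origin.

* A smooth point needs no blow-up, and has one point over it.
* At a singular point, blow up once. The strict transform meets the exceptional line in a finite
  set `S` of points, and then one goes on at each of these. -/
inductive ResolvedBy : MvPolynomial (Fin 2) ℂ → ℕ → ℕ → Prop
  | smooth (f : MvPolynomial (Fin 2) ℂ) (hf : mult f = 1) : ResolvedBy f 0 1
  | blowUp (f : MvPolynomial (Fin 2) ℂ) (m : ℕ) (hm : mult f = m) (hm2 : 2 ≤ m)
      (S : Finset (Option ℂ))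
      (hS : ∀ d, d ∈ S ↔ constantCoeff (strictTransform f m d) = 0)
      (n k : Option ℂ → ℕ)
      (h : ∀ d ∈ S, ResolvedBy (strictTransform f m d) (n d) (k d)) :
      ResolvedBy f (1 + ∑ d ∈ S, n d) (∑ d ∈ S, k d)

/-- The origin is a singularity of type `A_s` of the affine curve `f = 0`: it is a double point
and, writing `s = 2 r - ε` with `ε ∈ {0, 1}`, it is resolved by `r` blow-ups, and the
desingularization has two points over it if `ε = 1` and only one if `ε = 0`. -/
def IsTypeAAtOrigin (f : MvPolynomial (Fin 2) ℂ) (s : ℕ) : Prop :=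
  mult f = 2 ∧ ∃ r ε : ℕ, ε ≤ 1 ∧ s + ε = 2 * r ∧ ResolvedBy f r (1 + ε)

/-- The point `P` is a singularity of type `A_s` of the plane projective curve `F = 0`:
it is one in affine coordinates centred at `P`. -/
def IsTypeA (F : MvPolynomial (Fin 3) ℂ) (P : Projectivization ℂ (Fin 3 → ℂ)) (s : ℕ) : Prop :=
  ∃ g : GL (Fin 3) ℂ, IsCentredAt g P ∧ IsTypeAAtOrigin (affineEq F g) s

/-! ### The algorithm -/

/-- The intersection multiplicity at the origin of the curve `f = 0` and of the curve `y = γ(x)`,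
where `γ(0) = 0`: the least exponent of `x` that appears in `f(x, γ(x))`, and `⊤` if
`f(x, γ(x)) = 0`. -/
def interMult (f : MvPolynomial (Fin 2) ℂ) (γ : Polynomial ℂ) : ℕ∞ :=
  emultiplicity (Polynomial.X : Polynomial ℂ)
    (aeval ![(Polynomial.X : Polynomial ℂ), γ] f : Polynomial ℂ)

/-- The coefficient of `x ^ (2 r)` in `f(x, γ(x) + lam * x ^ r)`, as a polynomial in the unknown
`lam`. The computation takes place in `ℂ[lam][x]`. -/
def stepPoly (f : MvPolynomial (Fin 2) ℂ) (γ : Polynomial ℂ) (r : ℕ) : Polynomial ℂ :=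
  (aeval ![(Polynomial.X : Polynomial (Polynomial ℂ)),
      γ.map Polynomial.C + Polynomial.C Polynomial.X * Polynomial.X ^ r] f :
    Polynomial (Polynomial ℂ)).coeff (2 * r)

/-- The discriminant of the equation of second degree `stepPoly f γ r = 0` in `lam`. -/
def stepDiscr (f : MvPolynomial (Fin 2) ℂ) (γ : Polynomial ℂ) (r : ℕ) : ℂ :=
  discrim ((stepPoly f γ r).coeff 2) ((stepPoly f γ r).coeff 1) ((stepPoly f γ r).coeff 0)

/-- The states of the algorithm: the entry of Step 0; the entry of Step `r`, with
the curve `y = γ(x) = lam_1 x + ⋯ + lam_(r-1) x ^ (r-1)` found so far; and the four kinds of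
final states. -/
inductive State
  | step0
  | step (r : ℕ) (γ : Polynomial ℂ)
  | simplePoint
  | multiplicityAtLeastThree
  | stopA (r : ℕ)
  | stopB (r : ℕ)

/-- The transitions of the algorithm. Here `f₀` is the affine equation of the curve in the
coordinates chosen in Step 0 and `f` the affine equation in the coordinates chosen in Step 1. -/
inductive Next (f₀ f : MvPolynomial (Fin 2) ℂ) : State → State → Prop
  | simple (h : ¬ (a f₀ 0 1 = 0 ∧ a f₀ 1 0 = 0)) : Next f₀ f .step0 .simplePoint
  | multiple (h : a f₀ 0 1 = 0 ∧ a f₀ 1 0 = 0)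
      (h2 : a f₀ 2 0 = 0 ∧ a f₀ 1 1 = 0 ∧ a f₀ 0 2 = 0) :
      Next f₀ f .step0 .multiplicityAtLeastThree
  | double (h : a f₀ 0 1 = 0 ∧ a f₀ 1 0 = 0)
      (h2 : ¬ (a f₀ 2 0 = 0 ∧ a f₀ 1 1 = 0 ∧ a f₀ 0 2 = 0)) :
      Next f₀ f .step0 (.step 1 0)
  | caseA (r : ℕ) (γ : Polynomial ℂ) (hΔ : stepDiscr f γ r ≠ 0) :
      Next f₀ f (.step r γ) (.stopA r)
  | caseB1 (r : ℕ) (γ : Polynomial ℂ) (hΔ : stepDiscr f γ r = 0) (lam : ℂ)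
      (hlam : 2 * (r : ℕ∞) + 1 ≤ interMult f (γ + Polynomial.C lam * Polynomial.X ^ r))
      (hi : interMult f (γ + Polynomial.C lam * Polynomial.X ^ r) = 2 * (r : ℕ∞) + 1) :
      Next f₀ f (.step r γ) (.stopB r)
  | caseB2 (r : ℕ) (γ : Polynomial ℂ) (hΔ : stepDiscr f γ r = 0) (lam : ℂ)
      (hlam : 2 * (r : ℕ∞) + 1 ≤ interMult f (γ + Polynomial.C lam * Polynomial.X ^ r))
      (hi : 2 * (r : ℕ∞) + 2 ≤ interMult f (γ + Polynomial.C lam * Polynomial.X ^ r)) :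
      Next f₀ f (.step r γ) (.step (r + 1) (γ + Polynomial.C lam * Polynomial.X ^ r))

/-- The algorithm, started at Step 0, arrives at the state `s`. -/
def Reaches (f₀ f : MvPolynomial (Fin 2) ℂ) (s : State) : Prop :=
  Relation.ReflTransGen (Next f₀ f) .step0 s

/-- The algorithm stops at Step `r`-a, with the verdict `A_(2r-1)`. -/
def StopsAtStepA (f₀ f : MvPolynomial (Fin 2) ℂ) (r : ℕ) : Prop := Reaches f₀ f (.stopA r)

/-- The algorithm stops at Step `r`-b, with the verdict `A_(2r)`. -/
def StopsAtStepB (f₀ f : MvPolynomial (Fin 2) ℂ) (r : ℕ) : Prop := Reaches f₀ f (.stopB r)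

end PlaneCurve

end

noncomputable section

namespace PlaneCurve

open MvPolynomial

/-! ### Low-order coefficients and the multiplicity -/

/-! Both sides of each equivalence are compared with one invariant: the set `orders f` of finite
orders of vanishing of the equation along smooth formal arcs through the origin. For y² = x^(2r+1)
it is {2, 4, …, 2r, 2r+1}; for y² = x^(2r) it consists of 2, 4, …, 2r and all larger integers. In
both cases the least odd element is 2r+1, and 2r+2 belongs to the set only in the second.
`ContactType` records exactly this.

The invariant does not depend on the coordinates: a projective change fixing P sends smooth arcs to
smooth arcs and multiplies the equation along them by a power of a unit (`orders_affineEq_eq`).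

It behaves well under blow-up (`mem_orders_iff`): an arc not tangent to the double point has order
2, and an arc along a tangent lifts to an arc transverse to the exceptional line, with order smaller
by 2. Hence three cases: two tangents (r = 1, ε = 1); a double tangent with smooth strict transform
(r = 1, ε = 0); a double tangent with strict transform again a double point, where r drops by one
(`contactType_succ`).

The definition of `ResolvedBy` obeys the same recursion, and so does the algorithm: Δ₁ is the
discriminant of the tangent form, and Step r+1 for f with c x + x γ(x) is Step r for the strict
transform with γ. The condition a₀₂ ≠ 0 says that x = 0 is not a tangent; it passes to the strict
transform, so the chart y ↦ x (y + c) always suffices. The inductions `resolvedBy_iff_contactType`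
and `reaches_verdict_iff_contactType` meet at `ContactType`. -/

@[simp] lemma a_add (f g : MvPolynomial (Fin 2) ℂ) (i j : ℕ) : a (f + g) i j = a f i j + a g i j :=
  coeff_add _ _ _

@[simp] lemma a_C_zero (k : ℂ) : a (C k) 0 0 = k := by simp [a]

@[simp] lemma a_C_succ_left (k : ℂ) (i j : ℕ) : a (C k) (i + 1) j = 0 := by
  rw [a, coeff_C, if_neg]
  intro h
  simpa using DFunLike.congr_fun h 0

@[simp] lemma a_C_succ_right (k : ℂ) (i j : ℕ) : a (C k) i (j + 1) = 0 := by
  rw [a, coeff_C, if_neg]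
  intro h
  simpa using DFunLike.congr_fun h 1

@[simp] lemma a_X_zero_mul_succ (f : MvPolynomial (Fin 2) ℂ) (i j : ℕ) :
    a (X 0 * f) (i + 1) j = a f i j := by
  rw [a, Finsupp.single_add, add_comm (Finsupp.single 0 i), add_assoc, coeff_X_mul, a]

@[simp] lemma a_X_zero_mul_zero (f : MvPolynomial (Fin 2) ℂ) (j : ℕ) : a (X 0 * f) 0 j = 0 := by
  classical
  rw [a, coeff_X_mul', if_neg]
  simp

@[simp] lemma a_X_one_mul_succ (f : MvPolynomial (Fin 2) ℂ) (i j : ℕ) :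
    a (X 1 * f) i (j + 1) = a f i j := by
  rw [a, Finsupp.single_add, add_comm (Finsupp.single 1 j), add_left_comm, coeff_X_mul, a]

@[simp] lemma a_X_one_mul_zero (f : MvPolynomial (Fin 2) ℂ) (i : ℕ) : a (X 1 * f) i 0 = 0 := by
  classical
  rw [a, coeff_X_mul', if_neg]
  simp

lemma a_zero_zero (f : MvPolynomial (Fin 2) ℂ) : a f 0 0 = constantCoeff f := by
  simp [a, constantCoeff_eq]

lemma exists_eq_C_add (f : MvPolynomial (Fin 2) ℂ) :
    ∃ p q, f = C (a f 0 0) + X 0 * p + X 1 * q := by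
  induction f using MvPolynomial.induction_on with
  | C k => exact ⟨0, 0, by simp⟩
  | add f g hf hg =>
    obtain ⟨p, q, h⟩ := hf
    obtain ⟨p', q', h'⟩ := hg
    refine ⟨p + p', q + q', ?_⟩
    rw [a_add, C_add]
    linear_combination h + h'
  | mul_X f i _ =>
    have h : a (f * X i) 0 0 = 0 := by simp [a_zero_zero]
    rw [h]
    fin_cases i
    · exact ⟨f, 0, by simp [mul_comm]⟩
    · exact ⟨0, f, by simp [mul_comm]⟩

lemma exists_eq_linear_add (f : MvPolynomial (Fin 2) ℂ) :
    ∃ p q r, f = C (a f 0 0) + X 0 * C (a f 1 0) + X 1 * C (a f 0 1) +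
      X 0 * (X 0 * p) + X 0 * (X 1 * q) + X 1 * (X 1 * r) := by
  obtain ⟨p, q, h⟩ := exists_eq_C_add f
  obtain ⟨p₁, p₂, hp⟩ := exists_eq_C_add p
  obtain ⟨q₁, q₂, hq⟩ := exists_eq_C_add q
  have h10 : a f 1 0 = a p 0 0 := by
    rw [h]; simp [a_X_zero_mul_succ p 0 0, a_C_succ_left _ 0 0]
  have h01 : a f 0 1 = a q 0 0 := by
    rw [h]; simp [a_X_one_mul_succ q 0 0, a_C_succ_right _ 0 0]
  refine ⟨p₁, p₂ + q₁, q₂, ?_⟩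
  rw [h10, h01]
  linear_combination h + X 0 * hp + X 1 * hq

/-- The Taylor expansion of a polynomial at the origin up to the second order. -/
lemma exists_eq_quadratic_add (f : MvPolynomial (Fin 2) ℂ) :
    ∃ p q r s, f = C (a f 0 0) + X 0 * C (a f 1 0) + X 1 * C (a f 0 1) +
      X 0 ^ 2 * C (a f 2 0) + X 0 * X 1 * C (a f 1 1) + X 1 ^ 2 * C (a f 0 2) +
      X 0 ^ 3 * p + X 0 ^ 2 * X 1 * q + X 0 * X 1 ^ 2 * r + X 1 ^ 3 * s := by
  obtain ⟨p, q, r, h⟩ := exists_eq_linear_add f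
  obtain ⟨p₁, p₂, hp⟩ := exists_eq_C_add p
  obtain ⟨q₁, q₂, hq⟩ := exists_eq_C_add q
  obtain ⟨r₁, r₂, hr⟩ := exists_eq_C_add r
  have h20 : a f 2 0 = a p 0 0 := by
    rw [h]
    simp [a_X_zero_mul_succ _ 1 0, a_X_zero_mul_succ _ 0 0, a_C_succ_left _ 1 0,
      a_C_succ_left _ 0 0]
  have h11 : a f 1 1 = a q 0 0 := by
    rw [h]
    simp [a_X_zero_mul_succ _ 0 _, a_X_one_mul_succ _ _ 0, a_C_succ_left _ 0,
      a_C_succ_right _ _ 0]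
  have h02 : a f 0 2 = a r 0 0 := by
    rw [h]
    simp [a_X_one_mul_succ _ 0 1, a_X_one_mul_succ _ 0 0, a_C_succ_right _ 0 1,
      a_C_succ_right _ 0 0]
  refine ⟨p₁, p₂ + q₁, q₂ + r₁, r₂, ?_⟩
  rw [h20, h11, h02]
  linear_combination h + X 0 ^ 2 * hp + X 0 * X 1 * hq + X 1 ^ 2 * hr

lemma natCast_le_mult_iff (f : MvPolynomial (Fin 2) ℂ) (k : ℕ) :
    (k : ℕ∞) ≤ mult f ↔ ∀ i j, i + j < k → a f i j = 0 := by
  constructor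
  · intro h i j hij
    have := MvPowerSeries.coeff_of_lt_order (f := (f : MvPowerSeries (Fin 2) ℂ))
      (d := Finsupp.single 0 i + Finsupp.single 1 j)
      (lt_of_lt_of_le (by simpa [map_add] using mod_cast hij) h)
    rwa [MvPolynomial.coeff_coe] at this
  · intro h
    refine MvPowerSeries.le_order fun d hd => ?_
    have hd' : d = Finsupp.single 0 (d 0) + Finsupp.single 1 (d 1) := by
      ext i; fin_cases i <;> simp
    have hdeg : d.degree = d 0 + d 1 := by
      simp [Finsupp.degree_eq_sum]
    rw [MvPolynomial.coeff_coe, hd']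
    exact h _ _ (by rw [← hdeg]; exact_mod_cast hd)

lemma two_le_mult_iff (f : MvPolynomial (Fin 2) ℂ) :
    2 ≤ mult f ↔ a f 0 0 = 0 ∧ a f 1 0 = 0 ∧ a f 0 1 = 0 := by
  have h := natCast_le_mult_iff f 2
  rw [Nat.cast_ofNat] at h
  rw [h]
  constructor
  · intro h
    exact ⟨h 0 0 (by norm_num), h 1 0 (by norm_num), h 0 1 (by norm_num)⟩
  · rintro ⟨h0, h1, h2⟩ i j hij
    obtain ⟨rfl, rfl⟩ | ⟨rfl, rfl⟩ | ⟨rfl, rfl⟩ :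
      (i = 0 ∧ j = 0) ∨ (i = 1 ∧ j = 0) ∨ (i = 0 ∧ j = 1) := by omega
    all_goals assumption

lemma mult_eq_one_iff (f : MvPolynomial (Fin 2) ℂ) :
    mult f = 1 ↔ a f 0 0 = 0 ∧ ¬ (a f 1 0 = 0 ∧ a f 0 1 = 0) := by
  have h : (1 : ℕ∞) ≤ mult f ↔ a f 0 0 = 0 := by
    have h := natCast_le_mult_iff f 1
    rw [Nat.cast_one] at h
    rw [h]
    constructor
    · intro h
      exact h 0 0 (by norm_num)
    · rintro h0 i j hij
      obtain ⟨rfl, rfl⟩ : (i = 0 ∧ j = 0) := by omega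
      exact h0
  have h2 := two_le_mult_iff f
  have key : mult f = 1 ↔ 1 ≤ mult f ∧ ¬ 2 ≤ mult f := by
    generalize mult f = m
    induction m with
    | top => simp
    | coe m => norm_cast; omega
  rw [key, h, h2]
  tauto

lemma mult_eq_two_iff (f : MvPolynomial (Fin 2) ℂ) :
    mult f = 2 ↔ (a f 0 0 = 0 ∧ a f 1 0 = 0 ∧ a f 0 1 = 0) ∧
      ¬ (a f 2 0 = 0 ∧ a f 1 1 = 0 ∧ a f 0 2 = 0) := by
  have h2 := two_le_mult_iff f
  have h3 : 3 ≤ mult f ↔ (a f 0 0 = 0 ∧ a f 1 0 = 0 ∧ a f 0 1 = 0) ∧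
      (a f 2 0 = 0 ∧ a f 1 1 = 0 ∧ a f 0 2 = 0) := by
    have h := natCast_le_mult_iff f 3
    rw [Nat.cast_ofNat] at h
    rw [h]
    constructor
    · intro h
      refine ⟨⟨h 0 0 ?_, h 1 0 ?_, h 0 1 ?_⟩, h 2 0 ?_, h 1 1 ?_, h 0 2 ?_⟩ <;> norm_num
    · rintro ⟨⟨h0, h1, h2⟩, h3, h4, h5⟩ i j hij
      obtain ⟨rfl, rfl⟩ | ⟨rfl, rfl⟩ | ⟨rfl, rfl⟩ | ⟨rfl, rfl⟩ | ⟨rfl, rfl⟩ | ⟨rfl, rfl⟩ :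
        (i = 0 ∧ j = 0) ∨ (i = 1 ∧ j = 0) ∨ (i = 0 ∧ j = 1) ∨ (i = 2 ∧ j = 0) ∨
          (i = 1 ∧ j = 1) ∨ (i = 0 ∧ j = 2) := by omega
      all_goals assumption
  have key : mult f = 2 ↔ 2 ≤ mult f ∧ ¬ 3 ≤ mult f := by
    generalize mult f = m
    induction m with
    | top => simp
    | coe m => norm_cast; omega
  rw [key, h3, h2]
  tauto

/-! ### The exchange of the coordinates -/

/-- The exchange of the two coordinates. -/
def swap : MvPolynomial (Fin 2) ℂ →ₐ[ℂ] MvPolynomial (Fin 2) ℂ := aeval ![X 1, X 0]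

@[simp] lemma swap_X_zero : swap (X 0) = X 1 := by simp [swap]
@[simp] lemma swap_X_one : swap (X 1) = X 0 := by simp [swap]
@[simp] lemma swap_C (k : ℂ) : swap (C k) = C k := by simp [swap, algebraMap_eq]

lemma swap_swap (f : MvPolynomial (Fin 2) ℂ) : swap (swap f) = f := by
  have : swap.comp swap = AlgHom.id ℂ _ := by
    ext i : 1
    fin_cases i <;> simp
  exact DFunLike.congr_fun this f

lemma a_swap (f : MvPolynomial (Fin 2) ℂ) (i j : ℕ) : a (swap f) i j = a f j i := by
  induction f using MvPolynomial.induction_on generalizing i j with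
  | C k => cases i <;> cases j <;> simp
  | add f g hf hg => simp [hf, hg]
  | mul_X f k h =>
    fin_cases k <;> cases i <;> cases j <;>
      simp [mul_comm _ (X _ : MvPolynomial (Fin 2) ℂ), h]

lemma mult_swap_eq_one_iff (f : MvPolynomial (Fin 2) ℂ) : mult (swap f) = 1 ↔ mult f = 1 := by
  simp only [mult_eq_one_iff, a_swap]
  tauto

lemma mult_swap_eq_two_iff (f : MvPolynomial (Fin 2) ℂ) : mult (swap f) = 2 ↔ mult f = 2 := by
  simp only [mult_eq_two_iff, a_swap]
  tauto

/-! ### The strict transform at a double point -/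

/-- The value of the quadratic part of `f` at the direction `d`. -/
def tangentForm (f : MvPolynomial (Fin 2) ℂ) : Option ℂ → ℂ
  | some c => a f 2 0 + a f 1 1 * c + a f 0 2 * c ^ 2
  | none => a f 0 2

/-- The derivative of the quadratic part of `f` at the direction `d`. -/
def tangentDeriv (f : MvPolynomial (Fin 2) ℂ) : Option ℂ → ℂ
  | some c => a f 1 1 + 2 * a f 0 2 * c
  | none => a f 1 1

/-- Half the second derivative of the quadratic part of `f` at the direction `d`. -/
def tangentHess (f : MvPolynomial (Fin 2) ℂ) : Option ℂ → ℂ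
  | some _ => a f 0 2
  | none => a f 2 0

/-- The strict transform of a curve with a double point at the origin, at the point `d` of
the exceptional line, in coordinates for which the exceptional line is `x = 0`. -/
def transform (f : MvPolynomial (Fin 2) ℂ) : Option ℂ → MvPolynomial (Fin 2) ℂ
  | some c => strictTransform f 2 (some c)
  | none => swap (strictTransform f 2 none)

/-- After the substitution, the quadratic part becomes x² times its Taylor expansion in y at c, and
all higher terms are divisible by x³. So the division by x² is exact, and the restriction to the
exceptional line x = 0 is the tangent form. -/
lemma exists_transform_some (f : MvPolynomial (Fin 2) ℂ) (hf : 2 ≤ mult f) (c : ℂ) :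
    X 0 ^ 2 * transform f (some c) = aeval ![X 0, X 0 * (X 1 + C c)] f ∧
    ∃ R, transform f (some c) = C (tangentForm f (some c)) + X 1 * C (tangentDeriv f (some c)) +
      X 1 * (X 1 * C (a f 0 2)) + X 0 * R := by
  rw [two_le_mult_iff] at hf
  obtain ⟨p, q, r, s, h⟩ := exists_eq_quadratic_add f
  obtain ⟨h0, h1, h2⟩ := hf
  set φ : MvPolynomial (Fin 2) ℂ →ₐ[ℂ] MvPolynomial (Fin 2) ℂ :=
    aeval ![X 0, X 0 * (X 1 + C c)] with hφ
  have hφ0 : φ (X 0) = X 0 := by simp [hφ]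
  have hφ1 : φ (X 1) = X 0 * (X 1 + C c) := by simp [hφ]
  have hφC (k : ℂ) : φ (C k) = C k := by simp [hφ, algebraMap_eq]
  set R := φ p + (X 1 + C c) * φ q + (X 1 + C c) ^ 2 * φ r + (X 1 + C c) ^ 3 * φ s
  have key : φ f = X 0 ^ 2 * (C (tangentForm f (some c)) + X 1 * C (tangentDeriv f (some c)) +
      X 1 * (X 1 * C (a f 0 2)) + X 0 * R) := by
    conv_lhs => rw [h, h0, h1, h2]
    simp only [map_add, map_mul, map_pow, hφ0, hφ1, hφC, tangentForm, tangentDeriv, map_zero,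
      map_ofNat, R]
    ring
  have key2 : transform f (some c) = C (tangentForm f (some c)) +
      X 1 * C (tangentDeriv f (some c)) + X 1 * (X 1 * C (a f 0 2)) + X 0 * R := by
    rw [transform, strictTransform, ← hφ, key, X_pow_eq_monomial, divMonomial_monomial_mul]
  exact ⟨by rw [key, key2], R, key2⟩

/-- The vertical direction is the direction c = 0 after the exchange of the coordinates, so no
second computation is needed. -/
lemma strictTransform_none (f : MvPolynomial (Fin 2) ℂ) (hf : 2 ≤ mult f) :
    strictTransform f 2 none = swap (transform (swap f) (some 0)) := by
  have hs : 2 ≤ mult (swap f) := by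
    rw [two_le_mult_iff] at hf ⊢
    simp only [a_swap]
    tauto
  obtain ⟨h, -⟩ := exists_transform_some (swap f) hs 0
  have h2 : (aeval ![X 0 * X 1, X 1] f : MvPolynomial (Fin 2) ℂ) =
      X 1 ^ 2 * swap (transform (swap f) (some 0)) := by
    have := congrArg swap h
    rw [map_mul, map_pow, swap_X_zero] at this
    rw [this, swap, ← AlgHom.comp_apply, ← AlgHom.comp_apply]
    congr 1
    ext i : 1
    fin_cases i <;> simp [mul_comm]
  rw [strictTransform, h2, X_pow_eq_monomial, divMonomial_monomial_mul]

lemma transform_none (f : MvPolynomial (Fin 2) ℂ) (hf : 2 ≤ mult f) :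
    transform f none = transform (swap f) (some 0) := by
  change swap (strictTransform f 2 none) = _
  rw [strictTransform_none f hf, swap_swap]

lemma exists_transform_eq (f : MvPolynomial (Fin 2) ℂ) (hf : 2 ≤ mult f) (d : Option ℂ) :
    ∃ R, transform f d = C (tangentForm f d) + X 1 * C (tangentDeriv f d) +
      X 1 * (X 1 * C (tangentHess f d)) + X 0 * R := by
  cases d with
  | some c => exact (exists_transform_some f hf c).2
  | none =>
    have hs : 2 ≤ mult (swap f) := by
      rw [two_le_mult_iff] at hf ⊢
      simp only [a_swap]
      tauto
    obtain ⟨R, hR⟩ := (exists_transform_some (swap f) hs 0).2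
    refine ⟨R, ?_⟩
    rw [transform_none f hf, hR]
    simp [tangentForm, tangentDeriv, tangentHess, a_swap]

lemma a_transform (f : MvPolynomial (Fin 2) ℂ) (hf : 2 ≤ mult f) (d : Option ℂ) :
    a (transform f d) 0 0 = tangentForm f d ∧ a (transform f d) 0 1 = tangentDeriv f d ∧
      a (transform f d) 0 2 = tangentHess f d := by
  obtain ⟨R, hR⟩ := exists_transform_eq f hf d
  rw [hR]
  refine ⟨?_, ?_, ?_⟩
  · simp
  · simp [a_C_succ_right _ 0 0, a_X_one_mul_succ _ 0 0]
  · simp [a_C_succ_right _ 0 1, a_C_succ_right _ 0 0, a_X_one_mul_succ _ 0 1,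
      a_X_one_mul_succ _ 0 0]

lemma constantCoeff_strictTransform (f : MvPolynomial (Fin 2) ℂ) (hf : 2 ≤ mult f)
    (d : Option ℂ) : constantCoeff (strictTransform f 2 d) = tangentForm f d := by
  rw [← (a_transform f hf d).1, ← a_zero_zero]
  cases d with
  | some c => rfl
  | none => rw [transform, a_swap]

lemma mult_strictTransform_eq_one_iff (f : MvPolynomial (Fin 2) ℂ) (d : Option ℂ) :
    mult (strictTransform f 2 d) = 1 ↔ mult (transform f d) = 1 := by
  cases d with
  | some c => rfl
  | none => exact (mult_swap_eq_one_iff _).symm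

lemma mult_strictTransform_eq_two_iff (f : MvPolynomial (Fin 2) ℂ) (d : Option ℂ) :
    mult (strictTransform f 2 d) = 2 ↔ mult (transform f d) = 2 := by
  cases d with
  | some c => rfl
  | none => exact (mult_swap_eq_two_iff _).symm

/-- The tangents at a double point: one double tangent or two simple ones. -/
lemma tangents_of_mult_eq_two (f : MvPolynomial (Fin 2) ℂ) (hf : mult f = 2) :
    (∃ d, (∀ d', tangentForm f d' = 0 ↔ d' = d) ∧ tangentDeriv f d = 0 ∧ tangentHess f d ≠ 0 ∧
      discrim (a f 0 2) (a f 1 1) (a f 2 0) = 0) ∨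
    (∃ d₁ d₂, d₁ ≠ d₂ ∧ (∀ d', tangentForm f d' = 0 ↔ d' = d₁ ∨ d' = d₂) ∧
      tangentDeriv f d₁ ≠ 0 ∧ tangentDeriv f d₂ ≠ 0 ∧
      discrim (a f 0 2) (a f 1 1) (a f 2 0) ≠ 0) := by
  have hq := ((mult_eq_two_iff f).1 hf).2
  generalize h20 : a f 2 0 = A at *
  generalize h11 : a f 1 1 = B at *
  generalize h02 : a f 0 2 = D at *
  -- D vanishes exactly when the direction x = 0 is a tangent; otherwise both tangents are given by
  -- the quadratic formula.
  by_cases hD : D = 0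
  · subst hD
    by_cases hB : B = 0
    · subst hB
      left
      refine ⟨none, ?_, by simp [tangentDeriv, h11], by simpa [tangentHess, h20] using hq,
        by simp [discrim]⟩
      rintro (_ | c)
      · simp [tangentForm, h02]
      · simpa [tangentForm, h20, h11, h02] using hq
    · right
      refine ⟨none, some (-A / B), by simp, ?_, by simpa [tangentDeriv, h11],
        by simpa [tangentDeriv, h11, h02], by simpa [discrim]⟩
      rintro (_ | c)
      · simp [tangentForm, h02]
      · simp only [tangentForm, h20, h11, h02, reduceCtorEq, Option.some.injEq, false_or]
        rw [eq_div_iff hB]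
        constructor <;> intro h <;> linear_combination h
  · obtain ⟨s, hs⟩ := IsAlgClosed.exists_eq_mul_self (discrim D B A)
    have hroot (c : ℂ) : tangentForm f (some c) = 0 ↔
        c = (-B + s) / (2 * D) ∨ c = (-B - s) / (2 * D) := by
      rw [← quadratic_eq_zero_iff hD hs, tangentForm, h20, h11, h02]
      constructor <;> intro h <;> linear_combination h
    by_cases h0 : s = 0
    · subst h0
      left
      refine ⟨some (-B / (2 * D)), ?_, ?_, by simpa [tangentHess, h02], by simpa using hs⟩
      · rintro (_ | c)
        · simpa [tangentForm, h02]
        · rw [hroot]; simp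
      · simp only [tangentDeriv, h11, h02]; field_simp; ring
    · right
      refine ⟨some ((-B + s) / (2 * D)), some ((-B - s) / (2 * D)), ?_, ?_, ?_, ?_, ?_⟩
      · intro h
        rw [Option.some.injEq] at h
        field_simp at h
        apply h0
        linear_combination h / 2
      · rintro (_ | c)
        · simpa [tangentForm, h02]
        · rw [hroot]; simp
      · have : tangentDeriv f (some ((-B + s) / (2 * D))) = s := by
          simp only [tangentDeriv, h11, h02]; field_simp; ring
        rwa [this]
      · have : tangentDeriv f (some ((-B - s) / (2 * D))) = -s := by
          simp only [tangentDeriv, h11, h02]; field_simp; ring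
        rw [this]; exact neg_ne_zero.2 h0
      · rw [hs]; exact mul_ne_zero h0 h0

/-! ### Intersection multiplicities with smooth arcs -/

lemma order_X_pow_mul (n : ℕ) (p : PowerSeries ℂ) :
    (PowerSeries.X ^ n * p).order = n + p.order := by
  rw [PowerSeries.order_mul, PowerSeries.order_X_pow]

lemma order_eq_zero_iff (p : PowerSeries ℂ) :
    p.order = 0 ↔ PowerSeries.constantCoeff p ≠ 0 := by
  rw [ne_eq, ← PowerSeries.order_ne_zero_iff_constCoeff_eq_zero, ne_eq, not_not]

lemma order_X_pow_mul_eq_iff (n : ℕ) (p : PowerSeries ℂ) :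
    (PowerSeries.X ^ n * p).order = (n : ℕ∞) ↔ PowerSeries.constantCoeff p ≠ 0 := by
  rw [order_X_pow_mul, ← order_eq_zero_iff]
  generalize p.order = m
  induction m with
  | top => simp
  | coe m => norm_cast; omega

lemma aeval_C_eq (x : Fin 2 → PowerSeries ℂ) (k : ℂ) :
    aeval x (C k : MvPolynomial (Fin 2) ℂ) = PowerSeries.C k := by
  rw [aeval_C]; rfl

/-- The finite orders of vanishing at the origin of `f` along the smooth formal arcs
`t ↦ (t u(t), t v(t))`. -/
def orders (f : MvPolynomial (Fin 2) ℂ) : Set ℕ :=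
  {k | ∃ u v : PowerSeries ℂ,
    ¬ (PowerSeries.constantCoeff u = 0 ∧ PowerSeries.constantCoeff v = 0) ∧
      (aeval ![PowerSeries.X * u, PowerSeries.X * v] f).order = (k : ℕ∞)}

/-- The finite orders of vanishing at the origin of `f` along the smooth formal arcs which are
transverse to the line `x = 0`. -/
def transOrders (f : MvPolynomial (Fin 2) ℂ) : Set ℕ :=
  {k | ∃ u v : PowerSeries ℂ, PowerSeries.constantCoeff u ≠ 0 ∧
      (aeval ![PowerSeries.X * u, PowerSeries.X * v] f).order = (k : ℕ∞)}

lemma aeval_swap (f : MvPolynomial (Fin 2) ℂ) (x y : PowerSeries ℂ) :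
    aeval ![x, y] (swap f) = aeval ![y, x] f := by
  rw [swap, ← AlgHom.comp_apply]
  congr 1
  ext i : 1
  fin_cases i <;> simp

lemma orders_swap (f : MvPolynomial (Fin 2) ℂ) : orders (swap f) = orders f := by
  ext k
  constructor <;> rintro ⟨u, v, h, hk⟩ <;> refine ⟨v, u, by tauto, ?_⟩
  · rwa [aeval_swap] at hk
  · rwa [aeval_swap]

lemma exists_aeval_arc (f : MvPolynomial (Fin 2) ℂ) (hf : a f 0 0 = 0) (u v : PowerSeries ℂ) :
    ∃ R, aeval ![PowerSeries.X * u, PowerSeries.X * v] f =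
      PowerSeries.X * (PowerSeries.C (a f 1 0) * u + PowerSeries.C (a f 0 1) * v) +
      PowerSeries.X ^ 2 * (PowerSeries.C (a f 2 0) * u ^ 2 + PowerSeries.C (a f 1 1) * (u * v) +
        PowerSeries.C (a f 0 2) * v ^ 2) + PowerSeries.X ^ 3 * R := by
  obtain ⟨p, q, r, s, h⟩ := exists_eq_quadratic_add f
  set φ : MvPolynomial (Fin 2) ℂ →ₐ[ℂ] PowerSeries ℂ :=
    aeval ![PowerSeries.X * u, PowerSeries.X * v] with hφ
  have hφ0 : φ (X 0) = PowerSeries.X * u := by simp [hφ]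
  have hφ1 : φ (X 1) = PowerSeries.X * v := by simp [hφ]
  have hφC (k : ℂ) : φ (C k) = PowerSeries.C k := aeval_C_eq _ k
  refine ⟨u ^ 3 * φ p + u ^ 2 * v * φ q + u * v ^ 2 * φ r + v ^ 3 * φ s, ?_⟩
  conv_lhs => rw [h, hf]
  simp only [map_add, map_mul, map_pow, hφ0, hφ1, hφC, map_zero]
  ring

lemma exists_aeval_arc_of_two_le (f : MvPolynomial (Fin 2) ℂ) (hf : 2 ≤ mult f)
    (u v : PowerSeries ℂ) :
    ∃ R, aeval ![PowerSeries.X * u, PowerSeries.X * v] f =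
      PowerSeries.X ^ 2 * (PowerSeries.C (a f 2 0) * u ^ 2 + PowerSeries.C (a f 1 1) * (u * v) +
        PowerSeries.C (a f 0 2) * v ^ 2 + PowerSeries.X * R) := by
  rw [two_le_mult_iff] at hf
  obtain ⟨h0, h1, h2⟩ := hf
  obtain ⟨R, hR⟩ := exists_aeval_arc f h0 u v
  refine ⟨R, ?_⟩
  rw [hR, h1, h2, map_zero]
  ring

lemma order_aeval_arc_eq_two_iff (f : MvPolynomial (Fin 2) ℂ) (hf : 2 ≤ mult f)
    (u v : PowerSeries ℂ) :
    (aeval ![PowerSeries.X * u, PowerSeries.X * v] f).order = ((2 : ℕ) : ℕ∞) ↔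
      a f 2 0 * PowerSeries.constantCoeff u ^ 2 +
        a f 1 1 * (PowerSeries.constantCoeff u * PowerSeries.constantCoeff v) +
        a f 0 2 * PowerSeries.constantCoeff v ^ 2 ≠ 0 := by
  obtain ⟨R, hR⟩ := exists_aeval_arc_of_two_le f hf u v
  rw [hR, order_X_pow_mul_eq_iff]
  simp

lemma order_aeval_arc_eq_one_iff (f : MvPolynomial (Fin 2) ℂ) (hf : a f 0 0 = 0)
    (u v : PowerSeries ℂ) :
    (aeval ![PowerSeries.X * u, PowerSeries.X * v] f).order = ((1 : ℕ) : ℕ∞) ↔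
      a f 1 0 * PowerSeries.constantCoeff u + a f 0 1 * PowerSeries.constantCoeff v ≠ 0 := by
  obtain ⟨R, hR⟩ := exists_aeval_arc f hf u v
  have : aeval ![PowerSeries.X * u, PowerSeries.X * v] f = PowerSeries.X ^ 1 *
      (PowerSeries.C (a f 1 0) * u + PowerSeries.C (a f 0 1) * v +
      PowerSeries.X * (PowerSeries.C (a f 2 0) * u ^ 2 + PowerSeries.C (a f 1 1) * (u * v) +
        PowerSeries.C (a f 0 2) * v ^ 2 + PowerSeries.X * R)) := by
    rw [hR]; ring
  rw [this, order_X_pow_mul_eq_iff]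
  simp

/-- A nonzero linear part is nonzero on some direction, and a nonzero quadratic form likewise, so
the multiplicity can be read off the contact orders. This makes being a double point independent of
coordinates. -/
lemma mult_eq_two_iff_orders (f : MvPolynomial (Fin 2) ℂ) (hf : a f 0 0 = 0) :
    mult f = 2 ↔ 1 ∉ orders f ∧ 2 ∈ orders f := by
  by_cases h2 : 2 ≤ mult f
  · have h1 : 1 ∉ orders f := by
      rintro ⟨u, v, -, h⟩
      rw [order_aeval_arc_eq_one_iff f hf] at h
      rw [two_le_mult_iff] at h2
      simp [h2] at h
    rw [mult_eq_two_iff, ← two_le_mult_iff]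
    simp only [h2, h1, true_and, not_false_iff]
    constructor
    · intro h
      -- A binary quadratic form that vanishes at (1, 0), (0, 1) and (1, 1) is zero.
      obtain ⟨x, y, hxy, hne⟩ : ∃ x y : ℂ, ¬ (x = 0 ∧ y = 0) ∧
          a f 2 0 * x ^ 2 + a f 1 1 * (x * y) + a f 0 2 * y ^ 2 ≠ 0 := by
        by_cases h20 : a f 2 0 = 0
        · by_cases h02 : a f 0 2 = 0
          · exact ⟨1, 1, by simp, by simpa [h20, h02] using h⟩
          · exact ⟨0, 1, by simp, by simpa⟩
        · exact ⟨1, 0, by simp, by simpa⟩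
      refine ⟨PowerSeries.C x, PowerSeries.C y, by simpa using hxy, ?_⟩
      rw [order_aeval_arc_eq_two_iff f h2]
      simpa using hne
    · rintro ⟨u, v, -, h⟩ ⟨h3, h4, h5⟩
      rw [order_aeval_arc_eq_two_iff f h2] at h
      simp [h3, h4, h5] at h
  · have h1 : 1 ∈ orders f := by
      rw [two_le_mult_iff] at h2
      by_cases h10 : a f 1 0 = 0
      · refine ⟨0, 1, by simp, ?_⟩
        rw [order_aeval_arc_eq_one_iff f hf]
        simpa [hf, h10] using h2
      · refine ⟨1, 0, by simp, ?_⟩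
        rw [order_aeval_arc_eq_one_iff f hf]
        simpa
    simp only [h1, not_true, false_and, iff_false]
    intro h
    exact h2 h.ge

/-- The arc is the image of (t u, t w) under the blow-up, and f pulls back to x² times the strict
transform. Since u is a unit, x² = (t u)² contributes exactly 2. -/
lemma order_aeval_blowUp_some (f : MvPolynomial (Fin 2) ℂ) (hf : 2 ≤ mult f) (c : ℂ)
    (u w : PowerSeries ℂ) (hu : PowerSeries.constantCoeff u ≠ 0) :
    (aeval ![PowerSeries.X * u, PowerSeries.X * (u * (PowerSeries.X * w + PowerSeries.C c))]
        f).order =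
      2 + (aeval ![PowerSeries.X * u, PowerSeries.X * w] (transform f (some c))).order := by
  have h := congrArg (aeval ![PowerSeries.X * u, PowerSeries.X * w])
    (exists_transform_some f hf c).1
  rw [← AlgHom.comp_apply] at h
  have h2 : (aeval ![PowerSeries.X * u, PowerSeries.X * w]).comp
      (aeval ![X 0, X 0 * (X 1 + C c)] : MvPolynomial (Fin 2) ℂ →ₐ[ℂ] _) =
      aeval ![PowerSeries.X * u,
        PowerSeries.X * (u * (PowerSeries.X * w + PowerSeries.C c))] := by
    ext i : 1
    fin_cases i
    · simp
    · simp [mul_assoc]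
  rw [h2] at h
  rw [← h, map_mul, map_pow, aeval_X, Matrix.cons_val_zero, mul_pow, mul_assoc, order_X_pow_mul,
    PowerSeries.order_mul, PowerSeries.order_pow, (order_eq_zero_iff u).2 hu, smul_zero, zero_add]
  rfl

lemma order_aeval_blowUp_none (f : MvPolynomial (Fin 2) ℂ) (hf : 2 ≤ mult f)
    (u w : PowerSeries ℂ) (hu : PowerSeries.constantCoeff u ≠ 0) :
    (aeval ![PowerSeries.X * (u * (PowerSeries.X * w)), PowerSeries.X * u] f).order =
      2 + (aeval ![PowerSeries.X * u, PowerSeries.X * w] (transform f none)).order := by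
  have hs : 2 ≤ mult (swap f) := by
    rw [two_le_mult_iff] at hf ⊢
    simp only [a_swap]
    tauto
  rw [transform_none f hf, ← order_aeval_blowUp_some _ hs 0 u w hu, map_zero, add_zero,
    aeval_swap]

/-- The contact orders of a double point, in terms of those of its strict transforms. -/
lemma mem_orders_iff (f : MvPolynomial (Fin 2) ℂ) (hf : mult f = 2) (k : ℕ) :
    k ∈ orders f ↔ k = 2 ∨
      ∃ d, tangentForm f d = 0 ∧ ∃ k' ∈ transOrders (transform f d), k = k' + 2 := by
  have h2 : 2 ≤ mult f := hf.ge
  constructor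
  · rintro ⟨u, v, huv, hk⟩
    by_cases hq : a f 2 0 * PowerSeries.constantCoeff u ^ 2 +
        a f 1 1 * (PowerSeries.constantCoeff u * PowerSeries.constantCoeff v) +
        a f 0 2 * PowerSeries.constantCoeff v ^ 2 = 0
    · right
      by_cases hu : PowerSeries.constantCoeff u = 0
      · have hv : PowerSeries.constantCoeff v ≠ 0 := fun hv => huv ⟨hu, hv⟩
        -- The arc lifts with second coordinate u / v, which vanishes at t = 0 and hence is t w.
        obtain ⟨w, hw⟩ := PowerSeries.X_dvd_iff.2
          (show PowerSeries.constantCoeff (u * v⁻¹) = 0 by simp [hu])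
        have hwu : v * (PowerSeries.X * w) = u := by
          rw [← hw, mul_left_comm, PowerSeries.mul_inv_cancel v hv, mul_one]
        refine ⟨none, by simpa [hu, hv, tangentForm] using hq, ?_⟩
        have h := order_aeval_blowUp_none f h2 v w hv
        rw [hwu, hk] at h
        obtain ⟨k', hk'⟩ : ∃ k' : ℕ,
            (aeval ![PowerSeries.X * v, PowerSeries.X * w] (transform f none)).order =
              (k' : ℕ∞) := by
          refine ENat.ne_top_iff_exists.1 (fun h' => ?_) |>.imp fun _ => Eq.symm
          simp [h'] at h
        refine ⟨k', ⟨v, w, hv, hk'⟩, ?_⟩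
        rw [hk'] at h
        norm_cast at h
        omega
      · set c := PowerSeries.constantCoeff v / PowerSeries.constantCoeff u with hc
        obtain ⟨w, hw⟩ := PowerSeries.X_dvd_iff.2
          (show PowerSeries.constantCoeff (v * u⁻¹ - PowerSeries.C c) = 0 by
            simp [hc, div_eq_mul_inv])
        have hwv : u * (PowerSeries.X * w + PowerSeries.C c) = v := by
          rw [← hw, sub_add_cancel, mul_left_comm, PowerSeries.mul_inv_cancel u hu, mul_one]
        refine ⟨some c, ?_, ?_⟩
        · rw [tangentForm, hc]
          field_simp
          linear_combination hq
        have h := order_aeval_blowUp_some f h2 c u w hu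
        rw [hwv, hk] at h
        obtain ⟨k', hk'⟩ : ∃ k' : ℕ,
            (aeval ![PowerSeries.X * u, PowerSeries.X * w] (transform f (some c))).order =
              (k' : ℕ∞) := by
          refine ENat.ne_top_iff_exists.1 (fun h' => ?_) |>.imp fun _ => Eq.symm
          simp [h'] at h
        refine ⟨k', ⟨u, w, hu, hk'⟩, ?_⟩
        rw [hk'] at h
        norm_cast at h
        omega
    · left
      rw [← ne_eq, ← order_aeval_arc_eq_two_iff f h2, hk] at hq
      exact_mod_cast hq
  · rintro (rfl | ⟨d, -, k', ⟨u, w, hu, hk'⟩, rfl⟩)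
    · exact ((mult_eq_two_iff_orders f ((mult_eq_two_iff f).1 hf).1.1).1 hf).2
    · cases d with
      | none =>
        refine ⟨u * (PowerSeries.X * w), u, by tauto, ?_⟩
        rw [order_aeval_blowUp_none f h2 u w hu, hk']
        push_cast
        ring
      | some c =>
        refine ⟨u, u * (PowerSeries.X * w + PowerSeries.C c), by tauto, ?_⟩
        rw [order_aeval_blowUp_some f h2 c u w hu, hk']
        push_cast
        ring

/-! ### Arcs transverse to the exceptional line -/

lemma one_mem_transOrders (f : MvPolynomial (Fin 2) ℂ) (h0 : a f 0 0 = 0) (h1 : a f 0 1 ≠ 0) :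
    1 ∈ transOrders f := by
  refine ⟨1, PowerSeries.C ((1 - a f 1 0) / a f 0 1), by simp, ?_⟩
  rw [order_aeval_arc_eq_one_iff f h0]
  simp [mul_div_cancel₀ _ h1]

/-- The curve is smooth and transverse to x = 0, so transverse arcs can be tangent to it to any
prescribed order; only orders 1 and 2 are needed. -/
lemma two_mem_transOrders (f : MvPolynomial (Fin 2) ℂ) (h0 : a f 0 0 = 0) (h1 : a f 0 1 ≠ 0) :
    2 ∈ transOrders f := by
  -- The slope b cancels the coefficient of t, and b' is then chosen to make the coefficient of t²
  -- equal to 1.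
  set b := -a f 1 0 / a f 0 1 with hb
  set b' := (1 - (a f 2 0 + a f 1 1 * b + a f 0 2 * b ^ 2)) / a f 0 1 with hb'
  have e1 : PowerSeries.C (R := ℂ) (a f 1 0) + PowerSeries.C (a f 0 1) * PowerSeries.C b = 0 := by
    rw [← map_mul, ← map_add, ← map_zero PowerSeries.C]
    congr 1
    rw [hb]; field_simp; ring
  set v : PowerSeries ℂ := PowerSeries.C b + PowerSeries.X * PowerSeries.C b' with hv
  obtain ⟨R, hR⟩ := exists_aeval_arc f h0 1 v
  refine ⟨1, v, by simp, ?_⟩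
  have : aeval ![PowerSeries.X * 1, PowerSeries.X * v] f = PowerSeries.X ^ 2 *
      (PowerSeries.C (a f 0 1) * PowerSeries.C b' + PowerSeries.C (a f 2 0) +
        PowerSeries.C (a f 1 1) * v + PowerSeries.C (a f 0 2) * v ^ 2 + PowerSeries.X * R) := by
    rw [hR]
    linear_combination (exp := 1) PowerSeries.X * e1 +
      PowerSeries.X * PowerSeries.C (a f 0 1) * hv
  rw [this, order_X_pow_mul_eq_iff]
  have : a f 0 1 * b' + a f 2 0 + a f 1 1 * b + a f 0 2 * b ^ 2 = 1 := by
    rw [hb', mul_div_cancel₀ _ h1]; ring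
  simp [hv, this]

/-- The curve is smooth with tangent x = 0, so it is transverse to every arc that is not tangent to
that line. -/
lemma transOrders_of_tangent (f : MvPolynomial (Fin 2) ℂ) (h0 : a f 0 0 = 0) (h1 : a f 0 1 = 0)
    (h2 : a f 1 0 ≠ 0) : transOrders f = {1} := by
  have key (u v : PowerSeries ℂ) (hu : PowerSeries.constantCoeff u ≠ 0) :
      (aeval ![PowerSeries.X * u, PowerSeries.X * v] f).order = ((1 : ℕ) : ℕ∞) := by
    rw [order_aeval_arc_eq_one_iff f h0]
    simp [h1, h2, hu]
  ext k
  constructor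
  · rintro ⟨u, v, hu, hk⟩
    rw [key u v hu] at hk
    exact_mod_cast hk.symm
  · rintro rfl
    exact ⟨1, 0, by simp, key _ _ (by simp)⟩

/-- The arcs tangent to x = 0 have order 2 because the form is nonzero on that direction, and some
transverse direction also gives order 2. -/
lemma transOrders_eq_orders (f : MvPolynomial (Fin 2) ℂ) (hf : mult f = 2) (h : a f 0 2 ≠ 0) :
    transOrders f = orders f := by
  ext k
  constructor
  · rintro ⟨u, v, hu, hk⟩
    exact ⟨u, v, by tauto, hk⟩
  · rintro ⟨u, v, huv, hk⟩
    by_cases hu : PowerSeries.constantCoeff u = 0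
    · have hv : PowerSeries.constantCoeff v ≠ 0 := fun hv => huv ⟨hu, hv⟩
      have h2 : (aeval ![PowerSeries.X * u, PowerSeries.X * v] f).order = ((2 : ℕ) : ℕ∞) := by
        rw [order_aeval_arc_eq_two_iff f hf.ge]
        simp [hu, hv, h]
      obtain rfl : k = 2 := by
        rw [h2] at hk
        exact_mod_cast hk.symm
      obtain ⟨b, hb⟩ : ∃ b : ℂ, a f 2 0 + a f 1 1 * b + a f 0 2 * b ^ 2 ≠ 0 := by
        by_contra! hb
        apply h
        -- The second difference of the quadratic polynomial at 0 recovers its leading coefficient.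
        linear_combination (hb 1 + hb (-1)) / 2 - hb 0
      refine ⟨1, PowerSeries.C b, by simp, ?_⟩
      rw [order_aeval_arc_eq_two_iff f hf.ge]
      simpa using hb
    · exact ⟨u, v, hu, hk⟩

/-! ### The type of a double point in terms of contact orders -/

/-- The smallest odd contact order with smooth arcs is `2 r + 1`, and `2 r + 2` is a contact order
if and only if `ε = 1`. -/
def ContactType (S : Set ℕ) (r ε : ℕ) : Prop :=
  1 ≤ r ∧ 2 * r + 1 ∈ S ∧ (∀ j < r, 2 * j + 1 ∉ S) ∧ (2 * r + 2 ∈ S ↔ ε = 1)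

/-- At a simple tangent the strict transform is smooth and transverse to the exceptional line, so
its transverse orders 1 and 2 produce 3 and 4. -/
lemma contactType_of_two_tangents (f : MvPolynomial (Fin 2) ℂ) (hf : mult f = 2) {d : Option ℂ}
    (hd : tangentForm f d = 0) (hd' : tangentDeriv f d ≠ 0) (r ε : ℕ) :
    ContactType (orders f) r ε ↔ r = 1 ∧ ε = 1 := by
  have hT := a_transform f hf.ge d
  have h0 : a (transform f d) 0 0 = 0 := by rw [hT.1, hd]
  have h1 : a (transform f d) 0 1 ≠ 0 := by rwa [hT.2.1]
  have h3 : 3 ∈ orders f :=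
    (mem_orders_iff f hf 3).2 (Or.inr ⟨d, hd, 1, one_mem_transOrders _ h0 h1, rfl⟩)
  have h4 : 4 ∈ orders f :=
    (mem_orders_iff f hf 4).2 (Or.inr ⟨d, hd, 2, two_mem_transOrders _ h0 h1, rfl⟩)
  have hn : 1 ∉ orders f :=
    ((mult_eq_two_iff_orders f ((mult_eq_two_iff f).1 hf).1.1).1 hf).1
  constructor
  · rintro ⟨hr, -, hj, hε⟩
    obtain rfl : r = 1 := by
      by_contra hr1
      exact hj 1 (by omega) h3
    exact ⟨rfl, hε.1 h4⟩
  · rintro ⟨rfl, rfl⟩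
    refine ⟨le_rfl, h3, fun j hj => ?_, by simpa using h4⟩
    obtain rfl : j = 0 := by omega
    exact hn

lemma mem_orders_iff_of_double_tangent (f : MvPolynomial (Fin 2) ℂ) (hf : mult f = 2)
    {d : Option ℂ} (hd : ∀ d', tangentForm f d' = 0 ↔ d' = d) (k : ℕ) :
    k ∈ orders f ↔ k = 2 ∨ ∃ k' ∈ transOrders (transform f d), k = k' + 2 := by
  simp [mem_orders_iff f hf, hd]

/-- The strict transform is smooth and tangent to the exceptional line, so its only transverse order
is 1 and the contact orders are exactly 2 and 3. -/
lemma contactType_of_cusp (f : MvPolynomial (Fin 2) ℂ) (hf : mult f = 2) {d : Option ℂ}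
    (hd : ∀ d', tangentForm f d' = 0 ↔ d' = d) (hd' : tangentDeriv f d = 0)
    (h : a (transform f d) 1 0 ≠ 0) (r ε : ℕ) :
    ContactType (orders f) r ε ↔ r = 1 ∧ ε ≠ 1 := by
  have hT := a_transform f hf.ge d
  have hk (k : ℕ) : k ∈ orders f ↔ k = 2 ∨ k = 3 := by
    rw [mem_orders_iff_of_double_tangent f hf hd, transOrders_of_tangent _
      (by rw [hT.1, hd]) (by rw [hT.2.1, hd']) h]
    simp
  simp only [ContactType, hk]
  constructor
  · rintro ⟨-, h1, -, h2⟩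
    exact ⟨by omega, fun hε => by have := h2.2 hε; omega⟩
  · rintro ⟨rfl, hε⟩
    exact ⟨le_rfl, by omega, fun j hj => by omega, by omega⟩

lemma mult_transform (f : MvPolynomial (Fin 2) ℂ) (hf : mult f = 2) {d : Option ℂ}
    (hd : tangentForm f d = 0) (hd' : tangentDeriv f d = 0) (hd'' : tangentHess f d ≠ 0)
    (h : a (transform f d) 1 0 = 0) : mult (transform f d) = 2 := by
  have hT := a_transform f hf.ge d
  rw [mult_eq_two_iff, hT.1, hT.2.1, hT.2.2]
  tauto

/-- Here `orders f` is 2 together with the orders of the strict transform shifted by 2; the shift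
preserves parity, and the extra element 2 is even. -/
lemma contactType_succ (f : MvPolynomial (Fin 2) ℂ) (hf : mult f = 2) {d : Option ℂ}
    (hd : ∀ d', tangentForm f d' = 0 ↔ d' = d)
    (hd'' : tangentHess f d ≠ 0) (h : mult (transform f d) = 2) (r ε : ℕ) :
    ContactType (orders f) (r + 1) ε ↔ ContactType (orders (transform f d)) r ε := by
  have hT := a_transform f hf.ge d
  have hk (k : ℕ) : k + 2 ∈ orders f ↔ k = 0 ∨ k ∈ orders (transform f d) := by
    rw [mem_orders_iff_of_double_tangent f hf hd, transOrders_eq_orders _ h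
      (by rwa [hT.2.2])]
    simp
  have hn : 1 ∉ orders f :=
    ((mult_eq_two_iff_orders f ((mult_eq_two_iff f).1 hf).1.1).1 hf).1
  have hn' : 1 ∉ orders (transform f d) :=
    ((mult_eq_two_iff_orders _ ((mult_eq_two_iff _).1 h).1.1).1 h).1
  have h1 : 2 * (r + 1) + 1 ∈ orders f ↔ 2 * r + 1 ∈ orders (transform f d) := by
    rw [show 2 * (r + 1) + 1 = 2 * r + 1 + 2 by ring, hk]
    simp
  have h2 : 2 * (r + 1) + 2 ∈ orders f ↔ 2 * r + 2 ∈ orders (transform f d) := by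
    rw [show 2 * (r + 1) + 2 = 2 * r + 2 + 2 by ring, hk]
    simp
  have h3 : (∀ j < r + 1, 2 * j + 1 ∉ orders f) ↔
      ∀ j < r, 2 * j + 1 ∉ orders (transform f d) := by
    constructor
    · intro H j hj
      have := H (j + 1) (by omega)
      rw [show 2 * (j + 1) + 1 = 2 * j + 1 + 2 by ring, hk] at this
      tauto
    · rintro H (_ | j) hj
      · exact hn
      · rw [show 2 * (j + 1) + 1 = 2 * j + 1 + 2 by ring, hk]
        simpa using H j (by omega)
  simp only [ContactType, h1, h2, h3]
  constructor
  · rintro ⟨-, H⟩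
    refine ⟨?_, H⟩
    rcases r with _ | r
    -- For r = 0 the order 2 r + 1 would be 1, impossible at a double point.
    · exact absurd H.1 hn'
    · omega
  · rintro ⟨-, H⟩
    exact ⟨by omega, H⟩

/-! ### The recursion for the resolution by blow-ups -/

lemma resolvedBy_of_mult_eq_one (f : MvPolynomial (Fin 2) ℂ) (hf : mult f = 1) (n k : ℕ) :
    ResolvedBy f n k ↔ n = 0 ∧ k = 1 := by
  constructor
  · intro h
    cases h with
    | smooth => exact ⟨rfl, rfl⟩
    | blowUp _ m hm hm2 =>
      rw [hf] at hm
      have : m = 1 := by exact_mod_cast hm.symm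
      omega
  · rintro ⟨rfl, rfl⟩
    exact .smooth f hf

lemma resolvedBy_iff_of_mult_eq_two (f : MvPolynomial (Fin 2) ℂ) (hf : mult f = 2)
    (S : Finset (Option ℂ)) (hS : ∀ d, tangentForm f d = 0 ↔ d ∈ S) (N K : ℕ) :
    ResolvedBy f N K ↔ ∃ n k : Option ℂ → ℕ,
      (∀ d ∈ S, ResolvedBy (strictTransform f 2 d) (n d) (k d)) ∧
        N = 1 + ∑ d ∈ S, n d ∧ K = ∑ d ∈ S, k d := by
  constructor
  · intro h
    cases h with
    | smooth _ h1 =>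
      rw [hf] at h1
      exact absurd h1 (by decide)
    | blowUp _ m hm hm2 S' hS' n k h =>
      rw [hf] at hm
      obtain rfl : m = 2 := by exact_mod_cast hm.symm
      obtain rfl : S' = S := by
        ext d
        rw [hS', constantCoeff_strictTransform f hf.ge, hS]
      exact ⟨n, k, h, rfl, rfl⟩
  · rintro ⟨n, k, h, rfl, rfl⟩
    exact .blowUp f 2 hf le_rfl S
      (fun d => by rw [constantCoeff_strictTransform f hf.ge, hS]) n k h

lemma resolvedBy_of_two_tangents (f : MvPolynomial (Fin 2) ℂ) (hf : mult f = 2)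
    {d₁ d₂ : Option ℂ} (hne : d₁ ≠ d₂) (hd : ∀ d', tangentForm f d' = 0 ↔ d' = d₁ ∨ d' = d₂)
    (h₁ : tangentDeriv f d₁ ≠ 0) (h₂ : tangentDeriv f d₂ ≠ 0) (N K : ℕ) :
    ResolvedBy f N K ↔ N = 1 ∧ K = 2 := by
  classical
  have hsm (d : Option ℂ) (h : tangentForm f d = 0) (h' : tangentDeriv f d ≠ 0) (n k : ℕ) :
      ResolvedBy (strictTransform f 2 d) n k ↔ n = 0 ∧ k = 1 := by
    refine resolvedBy_of_mult_eq_one _ ?_ n k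
    have hT := a_transform f hf.ge d
    rw [mult_strictTransform_eq_one_iff, mult_eq_one_iff, hT.1, hT.2.1]
    tauto
  have e₁ := hsm d₁ ((hd d₁).2 (Or.inl rfl)) h₁
  have e₂ := hsm d₂ ((hd d₂).2 (Or.inr rfl)) h₂
  rw [resolvedBy_iff_of_mult_eq_two f hf {d₁, d₂} (by simpa using hd)]
  simp only [Finset.sum_pair hne, Finset.mem_insert, Finset.mem_singleton, forall_eq_or_imp,
    forall_eq, e₁, e₂]
  constructor
  · rintro ⟨n, k, ⟨⟨h1, h2⟩, h3, h4⟩, rfl, rfl⟩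
    omega
  · rintro ⟨rfl, rfl⟩
    exact ⟨fun _ => 0, fun _ => 1, by simp, rfl, rfl⟩

lemma resolvedBy_of_double_tangent (f : MvPolynomial (Fin 2) ℂ) (hf : mult f = 2)
    {d : Option ℂ} (hd : ∀ d', tangentForm f d' = 0 ↔ d' = d) (N K : ℕ) :
    ResolvedBy f N K ↔ ∃ n, N = n + 1 ∧ ResolvedBy (strictTransform f 2 d) n K := by
  rw [resolvedBy_iff_of_mult_eq_two f hf {d} (by simpa using hd)]
  simp only [Finset.sum_singleton, Finset.mem_singleton, forall_eq]
  constructor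
  · rintro ⟨n, k, h, rfl, rfl⟩
    exact ⟨n d, add_comm _ _, h⟩
  · rintro ⟨n, rfl, h⟩
    exact ⟨fun _ => n, fun _ => K, h, add_comm _ _, rfl⟩

lemma orders_strictTransform (f : MvPolynomial (Fin 2) ℂ) (d : Option ℂ) :
    orders (strictTransform f 2 d) = orders (transform f d) := by
  cases d with
  | some c => rfl
  | none => exact (orders_swap _).symm

/-- The resolution of a double point is determined by its contact orders with smooth arcs. -/
lemma resolvedBy_iff_contactType (r ε : ℕ) (hε : ε ≤ 1) (f : MvPolynomial (Fin 2) ℂ)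
    (hf : mult f = 2) : ResolvedBy f r (1 + ε) ↔ ContactType (orders f) r ε := by
  induction r generalizing f with
  | zero =>
    rcases tangents_of_mult_eq_two f hf with ⟨d, hd, -⟩ | ⟨d₁, d₂, hne, hd, h₁, h₂, -⟩
    · rw [resolvedBy_of_double_tangent f hf hd]
      simp [ContactType]
    · rw [resolvedBy_of_two_tangents f hf hne hd h₁ h₂]
      simp [ContactType]
  | succ r ih =>
    rcases tangents_of_mult_eq_two f hf with ⟨d, hd, hd', hd'', -⟩ | ⟨d₁, d₂, hne, hd, h₁, h₂, -⟩
    · rw [resolvedBy_of_double_tangent f hf hd]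
      simp only [Nat.add_right_cancel_iff, exists_eq_left']
      by_cases h : a (transform f d) 1 0 = 0
      · have hm := mult_transform f hf ((hd d).2 rfl) hd' hd'' h
        rw [ih _ ((mult_strictTransform_eq_two_iff f d).2 hm), orders_strictTransform,
          contactType_succ f hf hd hd'' hm]
      · have hT := a_transform f hf.ge d
        have hm : mult (transform f d) = 1 := by
          rw [mult_eq_one_iff, hT.1, (hd d).2 rfl]
          tauto
        rw [resolvedBy_of_mult_eq_one _ ((mult_strictTransform_eq_one_iff f d).2 hm),
          contactType_of_cusp f hf hd hd' h]
        omega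
    · rw [resolvedBy_of_two_tangents f hf hne hd h₁ h₂,
        contactType_of_two_tangents f hf ((hd d₁).2 (Or.inl rfl)) h₁]
      omega

/-! ### The algorithm on the strict transform -/

lemma emultiplicity_X_sq_mul (p : Polynomial ℂ) :
    emultiplicity Polynomial.X (Polynomial.X ^ 2 * p) = 2 + emultiplicity Polynomial.X p := by
  rw [emultiplicity_mul Polynomial.prime_X, emultiplicity_pow_self_of_prime Polynomial.prime_X]
  rfl

lemma interMult_transform (f : MvPolynomial (Fin 2) ℂ) (hf : 2 ≤ mult f) (c : ℂ)
    (γ : Polynomial ℂ) :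
    interMult f (Polynomial.C c * Polynomial.X + Polynomial.X * γ) =
      2 + interMult (transform f (some c)) γ := by
  have h := congrArg (aeval ![Polynomial.X, γ]) (exists_transform_some f hf c).1
  rw [← AlgHom.comp_apply] at h
  have h2 : (aeval ![Polynomial.X, γ]).comp
      (aeval ![X 0, X 0 * (X 1 + C c)] : MvPolynomial (Fin 2) ℂ →ₐ[ℂ] _) =
      aeval ![Polynomial.X, Polynomial.C c * Polynomial.X + Polynomial.X * γ] := by
    ext1 i
    fin_cases i
    · simp
    · simp; ring
  rw [h2] at h
  rw [interMult, interMult, ← h, map_mul, map_pow, aeval_X, Matrix.cons_val_zero,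
    emultiplicity_X_sq_mul]

/-- The curve y = c x + x (γ + λ x^r) lifts to y = γ + λ x^r, and the factor x² shifts the
coefficient of x^(2r+2) to that of x^(2r). -/
lemma stepPoly_transform (f : MvPolynomial (Fin 2) ℂ) (hf : 2 ≤ mult f) (c : ℂ)
    (γ : Polynomial ℂ) (r : ℕ) :
    stepPoly f (Polynomial.C c * Polynomial.X + Polynomial.X * γ) (r + 1) =
      stepPoly (transform f (some c)) γ r := by
  set y : Polynomial (Polynomial ℂ) :=
    γ.map Polynomial.C + Polynomial.C Polynomial.X * Polynomial.X ^ r with hy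
  have h := congrArg (aeval ![(Polynomial.X : Polynomial (Polynomial ℂ)), y])
    (exists_transform_some f hf c).1
  rw [← AlgHom.comp_apply] at h
  have h2 : (aeval ![(Polynomial.X : Polynomial (Polynomial ℂ)), y]).comp
      (aeval ![X 0, X 0 * (X 1 + C c)] : MvPolynomial (Fin 2) ℂ →ₐ[ℂ] _) =
      aeval ![(Polynomial.X : Polynomial (Polynomial ℂ)),
        (Polynomial.C c * Polynomial.X + Polynomial.X * γ).map Polynomial.C +
          Polynomial.C Polynomial.X * Polynomial.X ^ (r + 1)] := by
    ext1 i
    fin_cases i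
    · simp
    · simp [hy]; ring
  rw [h2] at h
  rw [stepPoly, stepPoly, ← h, map_mul, map_pow, aeval_X, Matrix.cons_val_zero,
    show 2 * (r + 1) = 2 * r + 2 by ring, Polynomial.coeff_X_pow_mul]

lemma stepPoly_one (f : MvPolynomial (Fin 2) ℂ) (hf : 2 ≤ mult f) :
    stepPoly f 0 1 = Polynomial.C (a f 2 0) + Polynomial.C (a f 1 1) * Polynomial.X +
      Polynomial.C (a f 0 2) * Polynomial.X ^ 2 := by
  -- The line y = λ x lifts, in the chart c = 0, to the line y = λ; the wanted coefficient of x² is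
  -- the value of the strict transform at x = 0.
  set φ : MvPolynomial (Fin 2) ℂ →ₐ[ℂ] Polynomial (Polynomial ℂ) :=
    aeval ![Polynomial.X, Polynomial.C Polynomial.X] with hφ
  obtain ⟨h, R, hR⟩ := exists_transform_some f hf 0
  have h := congrArg φ h
  rw [← AlgHom.comp_apply] at h
  have h2 : φ.comp (aeval ![X 0, X 0 * (X 1 + C 0)] : MvPolynomial (Fin 2) ℂ →ₐ[ℂ] _) =
      aeval ![(Polynomial.X : Polynomial (Polynomial ℂ)),
        (0 : Polynomial ℂ).map Polynomial.C + Polynomial.C Polynomial.X * Polynomial.X ^ 1] := by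
    ext1 i
    fin_cases i
    · simp [hφ]
    · simp [hφ]
  have hφ0 : φ (X 0) = Polynomial.X := by simp [hφ]
  have hφ1 : φ (X 1) = Polynomial.C Polynomial.X := by simp [hφ]
  have hφC (k : ℂ) : φ (C k) = Polynomial.C (Polynomial.C k) := by
    rw [hφ, aeval_C]; rfl
  rw [h2, hR] at h
  simp only [map_add, map_mul, map_pow, hφ0, hφ1, hφC] at h
  rw [stepPoly, ← h, show 2 * 1 = 0 + 2 by rfl, Polynomial.coeff_X_pow_mul]
  simp only [← map_mul, Polynomial.coeff_add, Polynomial.coeff_C_zero,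
    Polynomial.mul_coeff_zero, Polynomial.coeff_X_zero, zero_mul, add_zero]
  simp [tangentForm, tangentDeriv]
  ring

lemma stepDiscr_one (f : MvPolynomial (Fin 2) ℂ) (hf : 2 ≤ mult f) :
    stepDiscr f 0 1 = discrim (a f 0 2) (a f 1 1) (a f 2 0) := by
  rw [stepDiscr, stepPoly_one f hf]
  simp [Polynomial.coeff_X, Polynomial.coeff_C]

lemma le_interMult_zero_iff (f : MvPolynomial (Fin 2) ℂ) :
    (1 ≤ interMult f 0 ↔ a f 0 0 = 0) ∧ (2 ≤ interMult f 0 ↔ a f 0 0 = 0 ∧ a f 1 0 = 0) := by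
  obtain ⟨p, q, r, h⟩ := exists_eq_linear_add f
  set φ : MvPolynomial (Fin 2) ℂ →ₐ[ℂ] Polynomial ℂ := aeval ![Polynomial.X, 0] with hφ
  have hφ0 : φ (X 0) = Polynomial.X := by simp [hφ]
  have hφ1 : φ (X 1) = 0 := by simp [hφ]
  have hφC (k : ℂ) : φ (C k) = Polynomial.C k := by
    rw [hφ, aeval_C]; rfl
  have key : φ f = Polynomial.C (a f 0 0) + Polynomial.X * Polynomial.C (a f 1 0) +
      Polynomial.X * (Polynomial.X * φ p) := by
    conv_lhs => rw [h]
    simp only [map_add, map_mul, hφ0, hφ1, hφC]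
    ring
  have c0 : (φ f).coeff 0 = a f 0 0 := by rw [key]; simp
  have c1 : (φ f).coeff 1 = a f 1 0 := by
    rw [key]
    simp [Polynomial.coeff_C, Polynomial.coeff_X_mul _ 0]
  have e (n : ℕ) : (n : ℕ∞) ≤ interMult f 0 ↔ ∀ d < n, (φ f).coeff d = 0 := by
    rw [interMult, ← hφ, ← pow_dvd_iff_le_emultiplicity, Polynomial.X_pow_dvd_iff]
  have e1 := e 1
  have e2 := e 2
  rw [Nat.cast_one] at e1
  rw [Nat.cast_ofNat] at e2
  rw [e1, e2, ← c0, ← c1]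
  refine ⟨⟨fun H => H 0 (by norm_num), ?_⟩, ⟨fun H => ⟨H 0 (by norm_num), H 1 (by norm_num)⟩, ?_⟩⟩
  · intro H d hd
    interval_cases d
    exact H
  · rintro ⟨H, H'⟩ d hd
    interval_cases d
    exacts [H, H']

/-- The state of the algorithm for a curve that corresponds to a state of the algorithm for its
strict transform at the direction `y = c x`. -/
def State.lift (c : ℂ) : State → State
  | .step0 => .step0
  | .step r γ => .step (r + 1) (Polynomial.C c * Polynomial.X + Polynomial.X * γ)
  | .simplePoint => .simplePoint
  | .multiplicityAtLeastThree => .multiplicityAtLeastThree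
  | .stopA r => .stopA (r + 1)
  | .stopB r => .stopB (r + 1)

lemma two_mul_succ_add (r : ℕ) (k : ℕ∞) :
    2 * ((r + 1 : ℕ) : ℕ∞) + k = 2 + (2 * (r : ℕ∞) + k) := by
  push_cast
  ring

lemma two_add_le_iff (m n : ℕ∞) : 2 + m ≤ 2 + n ↔ m ≤ n :=
  ENat.add_le_add_iff_left (by decide)

lemma two_add_inj (m n : ℕ∞) : 2 + m = 2 + n ↔ m = n := by
  simp only [le_antisymm_iff, two_add_le_iff]

/-- The discriminants agree, and passing to the strict transform lowers by 2 both the intersection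
multiplicity and the threshold it is compared with. -/
lemma next_lift_iff (f₀ f : MvPolynomial (Fin 2) ℂ) (hf : 2 ≤ mult f) (c : ℂ) (r : ℕ)
    (γ : Polynomial ℂ) (s : State) :
    Next f₀ f (State.lift c (.step r γ)) s ↔
      ∃ t, s = State.lift c t ∧ Next f₀ (transform f (some c)) (.step r γ) t := by
  have hΔ : stepDiscr f (Polynomial.C c * Polynomial.X + Polynomial.X * γ) (r + 1) =
      stepDiscr (transform f (some c)) γ r := by
    rw [stepDiscr, stepDiscr, stepPoly_transform f hf]
  have hγ (l : ℂ) : Polynomial.C c * Polynomial.X + Polynomial.X * γ +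
      Polynomial.C l * Polynomial.X ^ (r + 1) =
      Polynomial.C c * Polynomial.X + Polynomial.X * (γ + Polynomial.C l * Polynomial.X ^ r) := by
    ring
  have h1 (l : ℂ) : 2 * ((r + 1 : ℕ) : ℕ∞) + 1 ≤ interMult f (Polynomial.C c * Polynomial.X +
      Polynomial.X * γ + Polynomial.C l * Polynomial.X ^ (r + 1)) ↔ 2 * (r : ℕ∞) + 1 ≤
      interMult (transform f (some c)) (γ + Polynomial.C l * Polynomial.X ^ r) := by
    rw [hγ, interMult_transform f hf, ← two_add_le_iff (2 * (r : ℕ∞) + 1),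
      two_mul_succ_add]
  have h1' (l : ℂ) : interMult f (Polynomial.C c * Polynomial.X +
      Polynomial.X * γ + Polynomial.C l * Polynomial.X ^ (r + 1)) =
      2 * ((r + 1 : ℕ) : ℕ∞) + 1 ↔
      interMult (transform f (some c)) (γ + Polynomial.C l * Polynomial.X ^ r) =
      2 * (r : ℕ∞) + 1 := by
    rw [hγ, interMult_transform f hf, ← two_add_inj _ (2 * (r : ℕ∞) + 1),
      two_mul_succ_add]
  have h2 (l : ℂ) : 2 * ((r + 1 : ℕ) : ℕ∞) + 2 ≤ interMult f (Polynomial.C c * Polynomial.X +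
      Polynomial.X * γ + Polynomial.C l * Polynomial.X ^ (r + 1)) ↔ 2 * (r : ℕ∞) + 2 ≤
      interMult (transform f (some c)) (γ + Polynomial.C l * Polynomial.X ^ r) := by
    rw [hγ, interMult_transform f hf, ← two_add_le_iff (2 * (r : ℕ∞) + 2),
      two_mul_succ_add]
  constructor
  · intro h
    cases h with
    | caseA _ _ h => exact ⟨.stopA r, rfl, .caseA r γ (by rwa [← hΔ])⟩
    | caseB1 _ _ h l hl hi =>
      exact ⟨.stopB r, rfl, .caseB1 r γ (by rwa [← hΔ]) l ((h1 l).1 hl) ((h1' l).1 hi)⟩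
    | caseB2 _ _ h l hl hi =>
      refine ⟨_, ?_, .caseB2 r γ (by rwa [← hΔ]) l ((h1 l).1 hl) ((h2 l).1 hi)⟩
      rw [State.lift, hγ]
  · rintro ⟨t, rfl, h⟩
    cases h with
    | caseA _ _ h => exact .caseA (r + 1) _ (by rwa [hΔ])
    | caseB1 _ _ h l hl hi =>
      exact .caseB1 (r + 1) _ (by rwa [hΔ]) l ((h1 l).2 hl) ((h1' l).2 hi)
    | caseB2 _ _ h l hl hi =>
      rw [State.lift, State.lift, ← hγ]
      exact .caseB2 (r + 1) _ (by rwa [hΔ]) l ((h1 l).2 hl) ((h2 l).2 hi)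

lemma next_step_of_ne (f₀ f : MvPolynomial (Fin 2) ℂ) {s t : State} (h : Next f₀ f s t)
    (hs : s ≠ .step0) : ∃ r γ, s = .step r γ := by
  cases h <;> simp_all

lemma ne_step0_of_next (f₀ f : MvPolynomial (Fin 2) ℂ) {s t : State} (h : Next f₀ f s t) :
    t ≠ .step0 := by
  cases h <;> simp

lemma reflTransGen_lift_iff (f₀ f : MvPolynomial (Fin 2) ℂ) (hf : 2 ≤ mult f) (c : ℂ) (r : ℕ)
    (γ : Polynomial ℂ) (s : State) :
    Relation.ReflTransGen (Next f₀ f) (State.lift c (.step r γ)) s ↔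
      ∃ t, s = State.lift c t ∧
        Relation.ReflTransGen (Next f₀ (transform f (some c))) (.step r γ) t := by
  constructor
  · intro h
    -- The entry state is excluded along the induction because its transitions do not correspond
    -- under the lift.
    suffices ∃ t, s = State.lift c t ∧ t ≠ .step0 ∧
        Relation.ReflTransGen (Next f₀ (transform f (some c))) (.step r γ) t by
      obtain ⟨t, h1, -, h2⟩ := this
      exact ⟨t, h1, h2⟩
    induction h with
    | refl => exact ⟨_, rfl, by simp, .refl⟩
    | tail _ hn ih =>
      obtain ⟨t, rfl, ht, h⟩ := ih
      obtain ⟨r', γ', hr'⟩ := next_step_of_ne _ _ hn (by cases t <;> simp_all [State.lift])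
      obtain ⟨r'', γ'', rfl⟩ : ∃ r γ, t = .step r γ := by cases t <;> simp_all [State.lift]
      obtain ⟨t', rfl, ht'⟩ := (next_lift_iff f₀ f hf c _ _ _).1 hn
      exact ⟨t', rfl, ne_step0_of_next _ _ ht', h.tail ht'⟩
  · rintro ⟨t, rfl, h⟩
    suffices t ≠ .step0 ∧
        Relation.ReflTransGen (Next f₀ f) (State.lift c (.step r γ)) (State.lift c t) from this.2
    induction h with
    | refl => exact ⟨by simp, .refl⟩
    | tail _ hn ih =>
      obtain ⟨r', γ', rfl⟩ := next_step_of_ne _ _ hn ih.1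
      exact ⟨ne_step0_of_next _ _ hn, ih.2.tail ((next_lift_iff f₀ f hf c _ _ _).2 ⟨_, rfl, hn⟩)⟩

/-- The states in which the algorithm stops with a verdict about a double point. -/
def State.IsVerdict (s : State) : Prop := ∃ r, s = .stopA r ∨ s = .stopB r

lemma reflTransGen_verdict_iff (f₀ f : MvPolynomial (Fin 2) ℂ) {s t : State} (hs : s.IsVerdict) :
    Relation.ReflTransGen (Next f₀ f) s t ↔ t = s := by
  rw [Relation.ReflTransGen.cases_head_iff]
  constructor
  · rintro (h | ⟨u, h, -⟩)
    · exact h.symm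
    · obtain ⟨r, rfl | rfl⟩ := hs <;> cases h
  · rintro rfl
    exact Or.inl rfl

/-! ### The first step of the algorithm -/

lemma interMult_one (f : MvPolynomial (Fin 2) ℂ) (hf : 2 ≤ mult f) (l : ℂ) :
    interMult f (0 + Polynomial.C l * Polynomial.X ^ 1) =
      2 + interMult (transform f (some l)) 0 := by
  rw [← interMult_transform f hf]
  congr 1
  ring

lemma three_le_interMult_one_iff (f : MvPolynomial (Fin 2) ℂ) (hf : 2 ≤ mult f) (l : ℂ) :
    2 * ((1 : ℕ) : ℕ∞) + 1 ≤ interMult f (0 + Polynomial.C l * Polynomial.X ^ 1) ↔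
      tangentForm f (some l) = 0 := by
  rw [interMult_one f hf, Nat.cast_one, mul_one, two_add_le_iff, (le_interMult_zero_iff _).1,
    (a_transform f hf (some l)).1]

lemma four_le_interMult_one_iff (f : MvPolynomial (Fin 2) ℂ) (hf : 2 ≤ mult f) (l : ℂ) :
    2 * ((1 : ℕ) : ℕ∞) + 2 ≤ interMult f (0 + Polynomial.C l * Polynomial.X ^ 1) ↔
      tangentForm f (some l) = 0 ∧ a (transform f (some l)) 1 0 = 0 := by
  rw [interMult_one f hf, Nat.cast_one, mul_one, two_add_le_iff, (le_interMult_zero_iff _).2,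
    (a_transform f hf (some l)).1]

lemma interMult_one_eq_three_iff (f : MvPolynomial (Fin 2) ℂ) (hf : 2 ≤ mult f) (l : ℂ) :
    interMult f (0 + Polynomial.C l * Polynomial.X ^ 1) = 2 * ((1 : ℕ) : ℕ∞) + 1 ↔
      tangentForm f (some l) = 0 ∧ a (transform f (some l)) 1 0 ≠ 0 := by
  have h1 := three_le_interMult_one_iff f hf l
  have h2 := four_le_interMult_one_iff f hf l
  have key (m : ℕ∞) : m = 2 * ((1 : ℕ) : ℕ∞) + 1 ↔
      2 * ((1 : ℕ) : ℕ∞) + 1 ≤ m ∧ ¬ 2 * ((1 : ℕ) : ℕ∞) + 2 ≤ m := by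
    induction m with
    | top => exact iff_of_false (by norm_cast) (fun h => h.2 le_top)
    | coe m => norm_cast; omega
  rw [key, h1, h2]
  tauto

lemma reaches_verdict_of_two_tangents (f₀ f : MvPolynomial (Fin 2) ℂ) (hf : mult f = 2)
    (hΔ : discrim (a f 0 2) (a f 1 1) (a f 2 0) ≠ 0) {s : State} (hs : s.IsVerdict) :
    Relation.ReflTransGen (Next f₀ f) (.step 1 0) s ↔ s = .stopA 1 := by
  rw [← stepDiscr_one f hf.ge] at hΔ
  rw [Relation.ReflTransGen.cases_head_iff]
  constructor
  · rintro (rfl | ⟨t, h, ht⟩)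
    · obtain ⟨r, h | h⟩ := hs <;> cases h
    · cases h with
      | caseA => exact (reflTransGen_verdict_iff f₀ f ⟨1, Or.inl rfl⟩).1 ht
      | caseB1 _ _ h => exact absurd h hΔ
      | caseB2 _ _ h => exact absurd h hΔ
  · rintro rfl
    exact Or.inr ⟨_, .caseA 1 0 hΔ, .refl⟩

lemma reaches_verdict_of_cusp (f₀ f : MvPolynomial (Fin 2) ℂ) (hf : mult f = 2)
    (hΔ : discrim (a f 0 2) (a f 1 1) (a f 2 0) = 0) {c : ℂ}
    (hc : ∀ d', tangentForm f d' = 0 ↔ d' = some c) (h : a (transform f (some c)) 1 0 ≠ 0)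
    {s : State} (hs : s.IsVerdict) :
    Relation.ReflTransGen (Next f₀ f) (.step 1 0) s ↔ s = .stopB 1 := by
  rw [← stepDiscr_one f hf.ge] at hΔ
  rw [Relation.ReflTransGen.cases_head_iff]
  constructor
  · rintro (rfl | ⟨t, hn, ht⟩)
    · obtain ⟨r, h | h⟩ := hs <;> cases h
    · cases hn with
      | caseA _ _ h => exact absurd hΔ h
      | caseB1 => exact (reflTransGen_verdict_iff f₀ f ⟨1, Or.inr rfl⟩).1 ht
      | caseB2 _ _ _ l hl hi =>
        rw [four_le_interMult_one_iff f hf.ge, hc, Option.some.injEq] at hi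
        obtain ⟨rfl, hi⟩ := hi
        exact absurd hi h
  · rintro rfl
    have h3 := (hc (some c)).2 rfl
    exact Or.inr ⟨_, .caseB1 1 0 hΔ c ((three_le_interMult_one_iff f hf.ge c).2 h3)
      ((interMult_one_eq_three_iff f hf.ge c).2 ⟨h3, h⟩), .refl⟩

/-- The only possible first move finds λ = c and enters Step 2 with y = c x, which is the lift of
the entry into Step 1 for the strict transform. -/
lemma reaches_verdict_of_double_tangent (f₀ f : MvPolynomial (Fin 2) ℂ) (hf : mult f = 2)
    (hΔ : discrim (a f 0 2) (a f 1 1) (a f 2 0) = 0) {c : ℂ}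
    (hc : ∀ d', tangentForm f d' = 0 ↔ d' = some c) (h : a (transform f (some c)) 1 0 = 0)
    {s : State} (hs : s.IsVerdict) :
    Relation.ReflTransGen (Next f₀ f) (.step 1 0) s ↔ ∃ t, s = State.lift c t ∧
      Relation.ReflTransGen (Next f₀ (transform f (some c))) (.step 1 0) t := by
  rw [← stepDiscr_one f hf.ge] at hΔ
  rw [← reflTransGen_lift_iff f₀ f hf.ge, Relation.ReflTransGen.cases_head_iff]
  have hγ : State.lift c (.step 1 0) = .step (1 + 1) (0 + Polynomial.C c * Polynomial.X ^ 1) := by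
    rw [State.lift]
    congr 1
    ring
  rw [hγ]
  constructor
  · rintro (rfl | ⟨t, hn, ht⟩)
    · obtain ⟨r, h | h⟩ := hs <;> cases h
    · cases hn with
      | caseA _ _ h => exact absurd hΔ h
      | caseB1 _ _ _ l hl hi =>
        rw [interMult_one_eq_three_iff f hf.ge, hc, Option.some.injEq] at hi
        obtain ⟨rfl, hi⟩ := hi
        exact absurd h hi
      | caseB2 _ _ _ l hl hi =>
        rw [three_le_interMult_one_iff f hf.ge, hc, Option.some.injEq] at hl
        rwa [hl] at ht
  · intro ht
    have h3 := (hc (some c)).2 rfl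
    exact Or.inr ⟨_, .caseB2 1 0 hΔ c ((three_le_interMult_one_iff f hf.ge c).2 h3)
      ((four_le_interMult_one_iff f hf.ge c).2 ⟨h3, h⟩), ht⟩

/-- The verdict of the algorithm is determined by the contact orders with smooth arcs. -/
lemma reaches_verdict_iff_contactType (f₀ : MvPolynomial (Fin 2) ℂ) (r : ℕ)
    (f : MvPolynomial (Fin 2) ℂ) (hf : mult f = 2) (h02 : a f 0 2 ≠ 0) :
    (Relation.ReflTransGen (Next f₀ f) (.step 1 0) (.stopA r) ↔ ContactType (orders f) r 1) ∧
    (Relation.ReflTransGen (Next f₀ f) (.step 1 0) (.stopB r) ↔ ContactType (orders f) r 0) := by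
  have hA (r) : State.IsVerdict (.stopA r) := ⟨r, Or.inl rfl⟩
  have hB (r) : State.IsVerdict (.stopB r) := ⟨r, Or.inr rfl⟩
  induction r generalizing f with
  | zero =>
    rcases tangents_of_mult_eq_two f hf with
      ⟨_ | c, hc, hc', hc'', hΔ⟩ | ⟨d₁, d₂, hne, hd, h₁, h₂, hΔ⟩
    · exact absurd ((hc none).2 rfl) h02
    · by_cases h : a (transform f (some c)) 1 0 = 0
      · rw [reaches_verdict_of_double_tangent f₀ f hf hΔ hc h (hA 0),
          reaches_verdict_of_double_tangent f₀ f hf hΔ hc h (hB 0)]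
        constructor <;> refine iff_of_false ?_ (fun h => by simpa using h.1) <;>
          rintro ⟨_ | _, h, -⟩ <;> simp [State.lift] at h
      · rw [reaches_verdict_of_cusp f₀ f hf hΔ hc h (hA 0),
          reaches_verdict_of_cusp f₀ f hf hΔ hc h (hB 0)]
        simp [ContactType]
    · rw [reaches_verdict_of_two_tangents f₀ f hf hΔ (hA 0),
        reaches_verdict_of_two_tangents f₀ f hf hΔ (hB 0)]
      simp [ContactType]
  | succ r ih =>
    rcases tangents_of_mult_eq_two f hf with
      ⟨_ | c, hc, hc', hc'', hΔ⟩ | ⟨d₁, d₂, hne, hd, h₁, h₂, hΔ⟩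
    · exact absurd ((hc none).2 rfl) h02
    · by_cases h : a (transform f (some c)) 1 0 = 0
      · have hm := mult_transform f hf ((hc (some c)).2 rfl) hc' hc'' h
        -- The strict transform has the same coefficient of y² as f, so the induction hypothesis
        -- applies without a new choice of coordinates.
        have ih := ih _ hm (by rwa [(a_transform f hf.ge (some c)).2.2])
        rw [reaches_verdict_of_double_tangent f₀ f hf hΔ hc h (hA _),
          reaches_verdict_of_double_tangent f₀ f hf hΔ hc h (hB _),
          contactType_succ f hf hc hc'' hm, contactType_succ f hf hc hc'' hm, ← ih.1, ← ih.2]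
        constructor
        · constructor
          · rintro ⟨t, ht, h⟩
            cases t <;> simp [State.lift] at ht
            rwa [ht]
          · exact fun h => ⟨_, rfl, h⟩
        · constructor
          · rintro ⟨t, ht, h⟩
            cases t <;> simp [State.lift] at ht
            rwa [ht]
          · exact fun h => ⟨_, rfl, h⟩
      · rw [reaches_verdict_of_cusp f₀ f hf hΔ hc h (hA _),
          reaches_verdict_of_cusp f₀ f hf hΔ hc h (hB _), contactType_of_cusp f hf hc hc' h,
          contactType_of_cusp f hf hc hc' h]
        simp
    · rw [reaches_verdict_of_two_tangents f₀ f hf hΔ (hA _),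
        reaches_verdict_of_two_tangents f₀ f hf hΔ (hB _),
        contactType_of_two_tangents f hf ((hd d₁).2 (Or.inl rfl)) h₁,
        contactType_of_two_tangents f hf ((hd d₁).2 (Or.inl rfl)) h₁]
      simp

/-! ### Independence of the projective coordinates -/

lemma aeval_mul_of_isHomogeneous {σ R A : Type*} [Fintype σ] [CommRing R] [CommRing A]
    [Algebra R A] {n : ℕ} {F : MvPolynomial σ R} (hF : F.IsHomogeneous n) (z : A) (w : σ → A) :
    aeval (fun i => z * w i) F = z ^ n * aeval w F := by
  rw [aeval_def, aeval_def, eval₂_eq', eval₂_eq', Finset.mul_sum]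
  refine Finset.sum_congr rfl fun d hd => ?_
  have hdeg : ∑ i, d i = n := by
    simpa [Finsupp.weight_apply, Finsupp.sum_fintype] using hF (mem_support_iff.1 hd)
  simp only [mul_pow, Finset.prod_mul_distrib, Finset.prod_pow_eq_pow_sum, hdeg]
  ring

lemma IsCentredAt.exists_eq {g : GL (Fin 3) ℂ} {P : Projectivization ℂ (Fin 3 → ℂ)}
    (hg : IsCentredAt g P) : ∃ μ : ℂ, μ ≠ 0 ∧ ∀ i, g.1 i 2 = μ * P.rep i := by
  rw [IsCentredAt, Projectivization.submodule_eq, Submodule.mem_span_singleton] at hg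
  obtain ⟨μ, hμ⟩ := hg
  have h (i : Fin 3) : g.1 i 2 = μ * P.rep i := by
    have := congrFun hμ i
    simp only [Pi.smul_apply, smul_eq_mul, Matrix.mulVec, dotProduct, Fin.sum_univ_three] at this
    simpa using this.symm
  refine ⟨μ, ?_, h⟩
  rintro rfl
  have hdet : g.1.det ≠ 0 := (Matrix.isUnit_iff_isUnit_det _).1 g.isUnit |>.ne_zero
  exact hdet (Matrix.det_eq_zero_of_column_eq_zero 2 fun i => by rw [h i, zero_mul])

lemma a_affineEq_zero_zero {n : ℕ} {F : MvPolynomial (Fin 3) ℂ} (hF : F.IsHomogeneous n)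
    {P : Projectivization ℂ (Fin 3 → ℂ)} (hP : eval P.rep F = 0) {g : GL (Fin 3) ℂ}
    (hg : IsCentredAt g P) : a (affineEq F g) 0 0 = 0 := by
  obtain ⟨μ, -, hμ⟩ := hg.exists_eq
  have h : constantCoeff (affineEq F g) = aeval (fun i => μ * P.rep i) F := by
    have h2 : constantCoeff (affineEq F g) = (aeval (fun _ => 0)) (affineEq F g) := by
      simp [aeval_zero']
    rw [h2, affineEq, ← AlgHom.comp_apply]
    congr 1
    ext i : 1
    simp [hμ]
  rw [a_zero_zero, h, aeval_mul_of_isHomogeneous hF, aeval_eq_eval, hP, mul_zero]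

lemma aeval_affineEq (F : MvPolynomial (Fin 3) ℂ) (g : GL (Fin 3) ℂ) (x y : PowerSeries ℂ) :
    aeval ![x, y] (affineEq F g) = aeval (fun i => PowerSeries.C (g.1 i 0) * x +
      PowerSeries.C (g.1 i 1) * y + PowerSeries.C (g.1 i 2)) F := by
  rw [affineEq, ← AlgHom.comp_apply]
  congr 1
  ext i : 1
  simp

/-- The transition matrix H fixes the point [0, 0, 1]. It sends an arc (x, y, 1) to a triple whose
last entry z is a unit; dividing by z gives an arc in the other chart, and by homogeneity the two
equations differ by the factor z^n, of order 0. -/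
lemma orders_affineEq_subset {n : ℕ} {F : MvPolynomial (Fin 3) ℂ} (hF : F.IsHomogeneous n)
    {P : Projectivization ℂ (Fin 3 → ℂ)} {g g' : GL (Fin 3) ℂ}
    (hg : IsCentredAt g P) (hg' : IsCentredAt g' P) :
    orders (affineEq F g) ⊆ orders (affineEq F g') := by
  obtain ⟨μ, hμ, h⟩ := hg.exists_eq
  obtain ⟨μ', hμ', h'⟩ := hg'.exists_eq
  set H : Matrix (Fin 3) (Fin 3) ℂ := (g'⁻¹ * g).1 with hH
  have hmul : g'.1 * H = g.1 := by
    rw [hH, ← Units.val_mul, mul_inv_cancel_left]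
  have hdet : H.det ≠ 0 := (Matrix.isUnit_iff_isUnit_det _).1 (g'⁻¹ * g).isUnit |>.ne_zero
  set l := μ / μ' with hl
  have hl0 : l ≠ 0 := div_ne_zero hμ hμ'
  have hcol : g.1.mulVec (Pi.single 2 1) = g'.1.mulVec (l • Pi.single 2 1) := by
    ext i
    rw [Matrix.mulVec_smul]
    simp only [Matrix.mulVec_single_one, Matrix.col_apply, Pi.smul_apply, smul_eq_mul, h, h', hl]
    field_simp
  have hH2 : H.mulVec (Pi.single 2 1) = l • Pi.single 2 1 := by
    rw [hH, Units.val_mul, ← Matrix.mulVec_mulVec, hcol, Matrix.mulVec_mulVec, ← Units.val_mul,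
      inv_mul_cancel, Units.val_one, Matrix.one_mulVec]
  have hH02 : H 0 2 = 0 := by simpa using congrFun hH2 0
  have hH12 : H 1 2 = 0 := by simpa using congrFun hH2 1
  have hH22 : H 2 2 = l := by simpa using congrFun hH2 2
  -- Up to a nonzero scalar this block is the action on tangent directions; its invertibility keeps
  -- the new arc smooth.
  have hblock : H 0 0 * H 1 1 - H 0 1 * H 1 0 ≠ 0 := by
    intro h0
    apply hdet
    rw [Matrix.det_fin_three, hH02, hH12]
    linear_combination H 2 2 * h0
  rintro k ⟨u, v, huv, hk⟩
  set z : PowerSeries ℂ := PowerSeries.C (H 2 0) * (PowerSeries.X * u) +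
    PowerSeries.C (H 2 1) * (PowerSeries.X * v) + PowerSeries.C (H 2 2) with hz
  have hz0 : PowerSeries.constantCoeff z = l := by simp [hz, hH22]
  have hzne : PowerSeries.constantCoeff z ≠ 0 := by rwa [hz0]
  have hzz : z * z⁻¹ = 1 := PowerSeries.mul_inv_cancel z hzne
  set u' := (PowerSeries.C (H 0 0) * u + PowerSeries.C (H 0 1) * v) * z⁻¹ with hu'
  set v' := (PowerSeries.C (H 1 0) * u + PowerSeries.C (H 1 1) * v) * z⁻¹ with hv'
  refine ⟨u', v', ?_, ?_⟩
  · rintro ⟨e1, e2⟩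
    simp only [hu', hv', map_mul, map_add, PowerSeries.constantCoeff_C,
      PowerSeries.constantCoeff_inv, mul_eq_zero, inv_eq_zero, hzne, or_false] at e1 e2
    refine huv ⟨mul_left_cancel₀ hblock ?_, mul_left_cancel₀ hblock ?_⟩
    · linear_combination H 1 1 * e1 - H 0 1 * e2
    · linear_combination H 0 0 * e2 - H 1 0 * e1
  · have key : (fun i => PowerSeries.C (g.1 i 0) * (PowerSeries.X * u) +
        PowerSeries.C (g.1 i 1) * (PowerSeries.X * v) + PowerSeries.C (g.1 i 2)) =
        fun i => z * (PowerSeries.C (g'.1 i 0) * (PowerSeries.X * u') +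
          PowerSeries.C (g'.1 i 1) * (PowerSeries.X * v') + PowerSeries.C (g'.1 i 2)) := by
      funext i
      have hc (j : Fin 3) : PowerSeries.C (R := ℂ) (g.1 i j) =
          PowerSeries.C (g'.1 i 0) * PowerSeries.C (H 0 j) +
          PowerSeries.C (g'.1 i 1) * PowerSeries.C (H 1 j) +
          PowerSeries.C (g'.1 i 2) * PowerSeries.C (H 2 j) := by
        rw [← hmul, Matrix.mul_apply, Fin.sum_univ_three]
        simp only [map_add, map_mul]
      rw [hc 0, hc 1, hc 2, hH02, hH12, hu', hv', map_zero]
      linear_combination (exp := 1) (-PowerSeries.C (g'.1 i 2)) * hz -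
        (PowerSeries.X * (PowerSeries.C (g'.1 i 0) *
          (PowerSeries.C (H 0 0) * u + PowerSeries.C (H 0 1) * v) + PowerSeries.C (g'.1 i 1) *
          (PowerSeries.C (H 1 0) * u + PowerSeries.C (H 1 1) * v))) * hzz
    rw [aeval_affineEq, key, aeval_mul_of_isHomogeneous hF, PowerSeries.order_mul,
      PowerSeries.order_pow, (order_eq_zero_iff z).2 hzne, smul_zero, zero_add] at hk
    rw [aeval_affineEq, hk]

lemma orders_affineEq_eq {n : ℕ} {F : MvPolynomial (Fin 3) ℂ} (hF : F.IsHomogeneous n)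
    {P : Projectivization ℂ (Fin 3 → ℂ)} {g g' : GL (Fin 3) ℂ}
    (hg : IsCentredAt g P) (hg' : IsCentredAt g' P) :
    orders (affineEq F g) = orders (affineEq F g') :=
  (orders_affineEq_subset hF hg hg').antisymm (orders_affineEq_subset hF hg' hg)

lemma mult_affineEq_eq_two_iff {n : ℕ} {F : MvPolynomial (Fin 3) ℂ} (hF : F.IsHomogeneous n)
    {P : Projectivization ℂ (Fin 3 → ℂ)} (hP : eval P.rep F = 0) {g g' : GL (Fin 3) ℂ}
    (hg : IsCentredAt g P) (hg' : IsCentredAt g' P) :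
    mult (affineEq F g) = 2 ↔ mult (affineEq F g') = 2 := by
  rw [mult_eq_two_iff_orders _ (a_affineEq_zero_zero hF hP hg),
    mult_eq_two_iff_orders _ (a_affineEq_zero_zero hF hP hg'), orders_affineEq_eq hF hg hg']

/-! ### Reduction of both sides to contact orders -/

lemma isTypeAAtOrigin_iff (f : MvPolynomial (Fin 2) ℂ) {s r ε : ℕ} (hε : ε ≤ 1)
    (hs : s + ε = 2 * r) : IsTypeAAtOrigin f s ↔ mult f = 2 ∧ ContactType (orders f) r ε := by
  refine and_congr_right fun hf => ?_
  rw [← resolvedBy_iff_contactType r ε hε f hf]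
  constructor
  -- The parity of s determines ε, and then r.
  · rintro ⟨r', ε', hε', hs', h⟩
    obtain rfl : r' = r := by omega
    obtain rfl : ε' = ε := by omega
    exact h
  · exact fun h => ⟨r, ε, hε, hs, h⟩

lemma isTypeA_iff {n : ℕ} {F : MvPolynomial (Fin 3) ℂ} (hF : F.IsHomogeneous n)
    {P : Projectivization ℂ (Fin 3 → ℂ)} (hP : eval P.rep F = 0) {g : GL (Fin 3) ℂ}
    (hg : IsCentredAt g P) {s r ε : ℕ} (hε : ε ≤ 1) (hs : s + ε = 2 * r) :
    IsTypeA F P s ↔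
      mult (affineEq F g) = 2 ∧ ContactType (orders (affineEq F g)) r ε := by
  constructor
  · rintro ⟨g', hg', h⟩
    rwa [isTypeAAtOrigin_iff _ hε hs, mult_affineEq_eq_two_iff hF hP hg' hg,
      orders_affineEq_eq hF hg' hg] at h
  · exact fun h => ⟨g, hg, (isTypeAAtOrigin_iff _ hε hs).2 h⟩

lemma reaches_verdict_iff (f₀ f : MvPolynomial (Fin 2) ℂ) (h0 : a f₀ 0 0 = 0) {s : State}
    (hs : s.IsVerdict) : Reaches f₀ f s ↔
      mult f₀ = 2 ∧ Relation.ReflTransGen (Next f₀ f) (.step 1 0) s := by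
  rw [Reaches, Relation.ReflTransGen.cases_head_iff, mult_eq_two_iff]
  constructor
  · rintro (rfl | ⟨t, hn, ht⟩)
    · obtain ⟨r, h | h⟩ := hs <;> cases h
    · cases hn with
      | simple =>
        rcases Relation.ReflTransGen.cases_head ht with rfl | ⟨_, h, -⟩
        · obtain ⟨r, h | h⟩ := hs <;> cases h
        · cases h
      | multiple =>
        rcases Relation.ReflTransGen.cases_head ht with rfl | ⟨_, h, -⟩
        · obtain ⟨r, h | h⟩ := hs <;> cases h
        · cases h
      | double h h2 => exact ⟨⟨⟨h0, h.2, h.1⟩, h2⟩, ht⟩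
  · rintro ⟨⟨⟨-, h10, h01⟩, h2⟩, ht⟩
    exact Or.inr ⟨_, .double ⟨h01, h10⟩ h2, ht⟩

end PlaneCurve

end

theorem proposition3p3 (n : ℕ) (hn : 0 < n) (F : MvPolynomial (Fin 3) ℂ)
    (hF : F.IsHomogeneous n) (hred : Squarefree F)
    (P : Projectivization ℂ (Fin 3 → ℂ)) (hP : MvPolynomial.eval P.rep F = 0)
    (g₀ g₁ : GL (Fin 3) ℂ)
    (hg₀ : PlaneCurve.IsCentredAt g₀ P) (hg₁ : PlaneCurve.IsCentredAt g₁ P)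
    (ha : PlaneCurve.mult (PlaneCurve.affineEq F g₀) = 2 →
      PlaneCurve.a (PlaneCurve.affineEq F g₁) 0 2 ≠ 0)
    (r : ℕ) (hr : 1 ≤ r) :
    (PlaneCurve.StopsAtStepA (PlaneCurve.affineEq F g₀) (PlaneCurve.affineEq F g₁) r ↔
      PlaneCurve.IsTypeA F P (2 * r - 1)) ∧
    (PlaneCurve.StopsAtStepB (PlaneCurve.affineEq F g₀) (PlaneCurve.affineEq F g₁) r ↔
      PlaneCurve.IsTypeA F P (2 * r)) := by
  have h0 := PlaneCurve.a_affineEq_zero_zero hF hP hg₀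
  have hmult := PlaneCurve.mult_affineEq_eq_two_iff hF hP hg₀ hg₁
  rw [PlaneCurve.isTypeA_iff hF hP hg₁ le_rfl (show 2 * r - 1 + 1 = 2 * r by omega),
    PlaneCurve.isTypeA_iff hF hP hg₁ zero_le_one (show 2 * r + 0 = 2 * r by omega),
    PlaneCurve.StopsAtStepA, PlaneCurve.StopsAtStepB,
    PlaneCurve.reaches_verdict_iff _ _ h0 ⟨r, Or.inl rfl⟩,
    PlaneCurve.reaches_verdict_iff _ _ h0 ⟨r, Or.inr rfl⟩, ← hmult]
  -- The multiplicity computed in the coordinates of Step 0 is transferred to those of Step 1, where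
  -- a₀₂ ≠ 0.
  have key (h : PlaneCurve.mult (PlaneCurve.affineEq F g₀) = 2) :=
    PlaneCurve.reaches_verdict_iff_contactType (PlaneCurve.affineEq F g₀) r _ (hmult.1 h) (ha h)
  exact ⟨and_congr_right fun h => (key h).1, and_congr_right fun h => (key h).2⟩
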